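/- Let $\xi$ be a probability measure on $\{0,1,2,\dots\}$ with $\sum_k k\,\xi(k)\le 1$ and, for each $k\ge 1$, let $\eta^{(k)}$ be a probability measure on $\{-1,0,1\}^k$ (with $\eta^{(0)}(\varnothing)=1$). A labelled tree is a finite rooted plane tree $t$ with a label $\ell_t(v)\in\mathbb Z$ at each vertex $v$, such that labels change by $-1$, $0$ or $1$ along edges; edges are oriented away from the root, and $|t|$ denotes the number of edges. For $x\in\mathbb Z$ let $\Pi_x$ be the law of the labelled Galton--Watson tree rooted at label $x$, which gives a labelled tree $t$ with root label $x$ the mass $\prod_{v}\xi(k_t(v))\,\eta^{(k_t(v))}([v]_t)$, where $k_t(v)$ is the number of children of $v$ and $[v]_t$ is the vector of label increments from $v$ to its children, from left to right. Let $\Pi^+$ be the law of the tree obtained from a tree with law $\Pi_1$ by deleting all vertices that have a strict ancestor with label $0$, and let $n_\tau$ be the number of vertices with label $0$ in $\tau$. Fix $V\ge 1$ with $\Pi_0(|T|=V)>0$, and let $\Pi_0^{(V)}=\Pi_0(\,\cdot\mid |T|=V)$. For $m\ge 1$ let $\bar{\mathcal X}_m=(X_m^+,X_m^-,M_m^-)$,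 where $X_m^+$ (resp. $X_m^-$) is the number of edges of $T$ from a vertex labelled $m-1$ to a vertex labelled $m$ (resp. from $m$ to $m-1$), and $M_m^-$ is the number of edges whose endpoints both have label at most $m-1$. For integers $p,q,v\ge 0$ let $$H(p,q,v)=\mathbb P\Big(\sum_{k=1}^p|\tau_k|=V-v-p\ \Big|\ \sum_{k=1}^p n_{\tau_k}=q\Big),$$ where $\tau_1,\dots,\tau_p$ are independent with law $\Pi^+$ (with $H=0$ if the conditioning event has probability zero). Then there is a transition kernel $P$ on $\mathbb N_{\ge 0}^3$ such that: 1. under $\Pi_0$, the process $(\bar{\mathcal X}_m)_{m\ge 1}$ is a time-homogeneous Markov chain with transition kernel $P$; 2. for all $m\ge1$ and all $x$ with $\Pi_0(\bar{\mathcal X}_m=x)>0$, one has $H(x)=\Pi_0(|T|=V\mid \bar{\mathcal X}_m=x)$ and $\sum_y P(x,y)H(y)=H(x)$; 3. for all $m\ge1$ and all $x$ with $\Pi_0^{(V)}(\bar{\mathcal X}_m=x)>0$, one has $H(x)>0$; 4. under $\Pi_0^{(V)}$, the process $(\bar{\mathcal X}_m)_{m\ge 1}$ is a time-homogeneous Markov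 chain, with transition kernel the $h$-transform $$P^{(V)}(x,y)=\frac{H(y)}{H(x)}\,P(x,y).$$ Here "Markov chain with transition kernel $K$" means: for all $m\ge1$ and all $x_1,\dots,x_m,y$ such that $\{\bar{\mathcal X}_1=x_1,\dots,\bar{\mathcal X}_m=x_m\}$ has positive probability, the conditional probability of $\{\bar{\mathcal X}_{m+1}=y\}$ given this event is $K(x_m,y)$. -/

import Mathlib

open MeasureTheory ProbabilityTheory
open scoped ENNReal

/-- Finite rooted plane trees with an integer label at each vertex: `node a cs` is the tree whose
root has label `a` and whose subtrees branching off the children of the root are, from left to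
right, the entries of `cs`. (That labels vary by `-1`, `0` or `1` along edges is imposed by the
displacement laws, which give weight zero to all other trees.) -/
inductive LTree : Type
  | node (a : ℤ) (cs : List LTree) : LTree

namespace LTree

/-- Every set of trees is measurable (there are countably many trees). -/
instance : MeasurableSpace LTree := ⊤

/-- The label of the root. -/
def rootLabel : LTree → ℤ
  | node a _ => a

/-- The list of the labels of all vertices. -/
def labels : LTree → List ℤ
  | node a cs => a :: cs.flatMap fun c => c.labels

/-- The list of all edges, oriented away from the root; an edge is recorded as the pair
(label of the parent, label of the child). -/
def edges : LTree → List (ℤ × ℤ)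
  | node a cs => cs.flatMap fun c => (a, c.rootLabel) :: c.edges

/-- The number `|t|` of edges. -/
def size (t : LTree) : ℕ := t.edges.length

/-- The number `n_t` of vertices with label `0`. -/
def zeros (t : LTree) : ℕ := t.labels.count 0

/-- The truncation `t^{[l]}`: delete all vertices that have a strict ancestor with label `l`. -/
def trunc (l : ℤ) : LTree → LTree
  | node a cs => node a (if a = l then [] else cs.map fun c => c.trunc l)

/-- `X_m^+`: the number of edges from a vertex labelled `m - 1` to a vertex labelled `m`. -/
def up (m : ℕ) (t : LTree) : ℕ := t.edges.count ((m : ℤ) - 1, (m : ℤ))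

/-- `X_m^-`: the number of edges from a vertex labelled `m` to a vertex labelled `m - 1`. -/
def down (m : ℕ) (t : LTree) : ℕ := t.edges.count ((m : ℤ), (m : ℤ) - 1)

/-- `M_m^-`: the number of edges with both endpoints having label at most `m - 1`. -/
def massBelow (m : ℕ) (t : LTree) : ℕ :=
  t.edges.countP fun e => e.1 ≤ (m : ℤ) - 1 ∧ e.2 ≤ (m : ℤ) - 1

/-- The triple `(X_m^+, X_m^-, M_m^-)`. -/
def profile (m : ℕ) (t : LTree) : ℕ × ℕ × ℕ := (t.up m, t.down m, t.massBelow m)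

/-- `Π(t) = ∏_v ξ(k(v)) η^{(k(v))}([v])`, where `k(v)` is the number of children of the vertex `v`
and `[v]` is the vector of the label increments from `v` to its children. -/
noncomputable def weight (ξ : PMF ℕ) (η : (k : ℕ) → PMF (Fin k → ℤ)) : LTree → ℝ≥0∞
  | node a cs =>
    ξ cs.length * η cs.length (fun i => (cs.get i).rootLabel - a) *
      (cs.map fun c => c.weight ξ η).prod

end LTree

/-- `Π_x`: the law of the labelled Galton-Watson tree rooted at `x`, i.e. the restriction of the
measure with weights `Π(t)` to the trees with root label `x`. -/
noncomputable def treeLaw (ξ : PMF ℕ) (η : (k : ℕ) → PMF (Fin k → ℤ)) (x : ℤ) : Measure LTree :=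
  (Measure.sum fun t : LTree => t.weight ξ η • Measure.dirac t).restrict {t | t.rootLabel = x}

/-- `Π_0^{(V)}`: the law `Π_0` conditioned on having `V` edges. -/
noncomputable def sizedLaw (ξ : PMF ℕ) (η : (k : ℕ) → PMF (Fin k → ℤ)) (V : ℕ) : Measure LTree :=
  (treeLaw ξ η 0)[|{t | t.size = V}]

/-- `Π^+`: the law of the truncation `T^{[0]}` when `T` has law `Π_1`. -/
noncomputable def posExcursionLaw (ξ : PMF ℕ) (η : (k : ℕ) → PMF (Fin k → ℤ)) : Measure LTree :=
  (treeLaw ξ η 1).map (LTree.trunc 0)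

/-- `H(p, q, v) = ℙ(∑ |τ_k| = V - v - p ∣ ∑ n_{τ_k} = q)` for `p` independent positive tree
excursions `τ_k` with law `Π^+`. -/
noncomputable def harmonicH (ξ : PMF ℕ) (η : (k : ℕ) → PMF (Fin k → ℤ)) (V : ℕ) :
    ℕ × ℕ × ℕ → ℝ≥0∞
  | (p, q, v) =>
    (Measure.pi fun _ : Fin p => posExcursionLaw ξ η)[|{τ | ∑ k, (τ k).zeros = q}]
      {τ | ((∑ k, (τ k).size : ℕ) : ℤ) = (V : ℤ) - v - p}

/-- The process `(Y m)`, `m ≥ 1`, with values in a countable set, is under `μ` a (time-homogeneous)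
Markov chain with transition probabilities `K x y` from `x` to `y`: given any past of positive
probability up to time `m`, the next value is `y` with probability `K (Y m) y`. -/
def IsMarkovChainWith {Ω S : Type*} [MeasurableSpace Ω] (μ : Measure Ω) (Y : ℕ → Ω → S)
    (K : S → S → ℝ≥0∞) : Prop :=
  ∀ m : ℕ, 1 ≤ m → ∀ s : ℕ → S,
    μ {ω | ∀ k, 1 ≤ k → k ≤ m → Y k ω = s k} ≠ 0 →
      ∀ y : S, μ[|{ω | ∀ k, 1 ≤ k → k ≤ m → Y k ω = s k}] {ω | Y (m + 1) ω = y} = K (s m) y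

/-! Cut a tree between two consecutive labels, which after a shift of the labels are 0 and 1. Above
the cut lie `p` excursions, one per upward crossing; the pieces below are glued to them through the
upward crossings and the `q` downward ones. The number of gluings depends on how the leaves are
distributed among the pieces, so it is not evident that, given the profile, the excursions are
independent up to conditioning on `q` zeros in total. Two-type Lagrange inversion settles this.

Attach a variable to each edge type `(a, b)` and let `T_x` be the weighted generating series of the
trees with root label `x`. Put `y = X (0, 1)`, `r = X (1, 0)`, `U = y T_1`, `D = r T_0`. Truncation
at the cut gives `U = y E(D)`, `D = r F(U)` and `T_x = G(U)` for `x ≤ 0`, where `E` enumerates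
positive excursions by their zeros, `F` and `G` enumerate truncated trees below the cut, and none of
the three involves `y` or `r`. In bidegree `(p, q)` one has `p U^k = k y^p r^q [z^q]E^p
[z^(p-k)]F^q` (`natCast_mul_bidegPart_pow`). Thus `E` enters only through `[z^q]E^p`, the series of
`p` excursions with `q` zeros in total, and the series of trees factorizes at the cut
(`exists_bidegPart_rootSeries_eq`).

Profiles up to level `m` see the upper factor only through `q`, while the next profile and the total
size see the lower factor only through `p` and `v`. Hence, given the past, the pair (next profile,
size) is a function of the current state and of `p` conditioned excursions (`exists_treeLaw_eq_mul`,
`treeLaw_eq_mul_excursionLaw`). This yields the Markov property and identifies `H` as a conditional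
probability; harmonicity is then the law of total probability and the `h`-transform is Bayes'
formula.

Coefficients in `[0, ∞]` make every rearrangement legitimate. Of the total mass of the tree law,
only that it is finite and nonzero is needed. -/

namespace MvPowerSeries

/-! ### Power series over `[0, ∞]`: infinite sums and evaluation -/

variable {σ ι κ : Type*}

/-- The coefficientwise sum of a family of power series with coefficients in `[0, ∞]`. -/
noncomputable def seriesSum (f : ι → MvPowerSeries σ ℝ≥0∞) : MvPowerSeries σ ℝ≥0∞ :=
  fun N => ∑' i, coeff N (f i)

theorem coeff_seriesSum (f : ι → MvPowerSeries σ ℝ≥0∞) (N : σ →₀ ℕ) :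
    coeff N (seriesSum f) = ∑' i, coeff N (f i) := rfl

theorem mul_seriesSum (a : MvPowerSeries σ ℝ≥0∞) (f : ι → MvPowerSeries σ ℝ≥0∞) :
    a * seriesSum f = seriesSum fun i => a * f i := by
  classical
  ext N
  simp only [coeff_mul, coeff_seriesSum, ← ENNReal.tsum_mul_left]
  rw [Summable.tsum_finsetSum fun _ _ => ENNReal.summable]

theorem seriesSum_mul (a : MvPowerSeries σ ℝ≥0∞) (f : ι → MvPowerSeries σ ℝ≥0∞) :
    seriesSum f * a = seriesSum fun i => f i * a := by
  rw [mul_comm, mul_seriesSum]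
  simp only [mul_comm]

theorem seriesSum_comm (f : ι → κ → MvPowerSeries σ ℝ≥0∞) :
    (seriesSum fun i => seriesSum fun j => f i j) = seriesSum fun j => seriesSum fun i => f i j := by
  ext N
  simp only [coeff_seriesSum]
  exact ENNReal.tsum_comm

theorem seriesSum_prod (f : ι → κ → MvPowerSeries σ ℝ≥0∞) :
    (seriesSum fun p : ι × κ => f p.1 p.2) = seriesSum fun i => seriesSum fun j => f i j := by
  ext N
  simp only [coeff_seriesSum]
  exact ENNReal.tsum_prod (f := fun i j => coeff N (f i j))

theorem seriesSum_equiv (e : ι ≃ κ) (f : κ → MvPowerSeries σ ℝ≥0∞) :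
    (seriesSum fun i => f (e i)) = seriesSum f := by
  ext N
  simp only [coeff_seriesSum]
  exact e.tsum_eq fun j => coeff N (f j)

theorem seriesSum_zero : (seriesSum fun _ : ι => (0 : MvPowerSeries σ ℝ≥0∞)) = 0 := by
  ext N
  simp [coeff_seriesSum]

theorem seriesSum_eq_single [DecidableEq ι] (i : ι) (f : ι → MvPowerSeries σ ℝ≥0∞)
    (h : ∀ j, j ≠ i → f j = 0) : seriesSum f = f i := by
  ext N
  rw [coeff_seriesSum]
  exact tsum_eq_single i fun j hj => by rw [h j hj, map_zero]

theorem seriesSum_ite_eq [DecidableEq ι] (i : ι) (f : ι → MvPowerSeries σ ℝ≥0∞) :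
    (seriesSum fun j => if i = j then f j else 0) = f i := by
  rw [seriesSum_eq_single i _ fun j hj => if_neg hj.symm, if_pos rfl]

theorem seriesSum_fiber [DecidableEq κ] (h : ι → κ) (f : ι → MvPowerSeries σ ℝ≥0∞) :
    seriesSum f = seriesSum fun j => seriesSum fun i => if h i = j then f i else 0 := by
  rw [seriesSum_comm]
  congr 1
  funext i
  rw [seriesSum_ite_eq (h i) fun _ => f i]

theorem seriesSum_antidiagonal (f : ℕ → ℕ → MvPowerSeries σ ℝ≥0∞) :
    (seriesSum fun n => ∑ p ∈ Finset.HasAntidiagonal.antidiagonal n, f p.1 p.2) =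
      seriesSum fun i => seriesSum fun j => f i j := by
  ext N
  simp only [coeff_seriesSum, map_sum]
  rw [← ENNReal.tsum_prod (f := fun i j => coeff N (f i j)),
    ← Finset.HasAntidiagonal.sigmaAntidiagonalEquivProd.tsum_eq, ENNReal.tsum_sigma']
  congr 1
  funext n
  rw [← Finset.tsum_subtype (Finset.HasAntidiagonal.antidiagonal n) fun p => coeff N (f p.1 p.2)]
  rfl

/-- The value at `x` of a univariate power series over `[0, ∞]`-valued power series. -/
noncomputable def sumEval (F : PowerSeries (MvPowerSeries σ ℝ≥0∞)) (x : MvPowerSeries σ ℝ≥0∞) :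
    MvPowerSeries σ ℝ≥0∞ :=
  seriesSum fun n => PowerSeries.coeff n F * x ^ n

/-- Cauchy product. No convergence or vanishing constant term is required of `x`, since sums in `[0,
∞]` can be rearranged freely. -/
theorem sumEval_mul (F G : PowerSeries (MvPowerSeries σ ℝ≥0∞)) (x : MvPowerSeries σ ℝ≥0∞) :
    sumEval (F * G) x = sumEval F x * sumEval G x := by
  simp only [sumEval, seriesSum_mul, mul_seriesSum, PowerSeries.coeff_mul, Finset.sum_mul]
  rw [seriesSum_comm, ← seriesSum_antidiagonal]
  congr 1
  funext n
  refine Finset.sum_congr rfl fun p hp => ?_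
  rw [← Finset.HasAntidiagonal.mem_antidiagonal.1 hp, pow_add]
  ring

theorem sumEval_one (x : MvPowerSeries σ ℝ≥0∞) : sumEval 1 x = 1 := by
  rw [sumEval, seriesSum_eq_single 0]
  · simp
  · intro n hn
    simp [PowerSeries.coeff_one, hn]

theorem sumEval_pow (F : PowerSeries (MvPowerSeries σ ℝ≥0∞)) (x : MvPowerSeries σ ℝ≥0∞) (k : ℕ) :
    sumEval (F ^ k) x = sumEval F x ^ k := by
  induction k with
  | zero => simp [sumEval_one]
  | succ k ih => rw [pow_succ, sumEval_mul, ih, pow_succ]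

/-! ### Supports and bidegree parts -/

/-- All monomials of `s` involve only variables in `A`. -/
def SupportedOn (A : σ → Prop) (s : MvPowerSeries σ ℝ≥0∞) : Prop :=
  ∀ N, coeff N s ≠ 0 → ∀ e, N e ≠ 0 → A e

namespace SupportedOn

variable {A B : σ → Prop} {s t : MvPowerSeries σ ℝ≥0∞}

theorem mono (h : SupportedOn A s) (hAB : ∀ e, A e → B e) : SupportedOn B s :=
  fun N hN e he => hAB e (h N hN e he)

theorem mul (hs : SupportedOn A s) (ht : SupportedOn A t) : SupportedOn A (s * t) := by
  classical
  intro N hN e he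
  rw [coeff_mul] at hN
  obtain ⟨p, hp, hne⟩ := Finset.exists_ne_zero_of_sum_ne_zero hN
  rw [← Finset.HasAntidiagonal.mem_antidiagonal.1 hp, Finsupp.add_apply] at he
  rcases Nat.eq_zero_or_pos (p.1 e) with h | h
  · exact ht _ (right_ne_zero_of_mul hne) e (by omega)
  · exact hs _ (left_ne_zero_of_mul hne) e (by omega)

theorem C (a : ℝ≥0∞) : SupportedOn A (MvPowerSeries.C a) := by
  classical
  intro N hN e he
  rw [coeff_C] at hN
  split_ifs at hN with h
  · simp [h] at he
  · exact absurd rfl hN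

theorem one : SupportedOn A (1 : MvPowerSeries σ ℝ≥0∞) := by
  simpa using C (A := A) 1

theorem natCast (n : ℕ) : SupportedOn A (n : MvPowerSeries σ ℝ≥0∞) := by
  simpa using C (A := A) n

theorem zero : SupportedOn A (0 : MvPowerSeries σ ℝ≥0∞) := by
  simpa using C (A := A) 0

theorem X {e : σ} (he : A e) : SupportedOn A (MvPowerSeries.X e : MvPowerSeries σ ℝ≥0∞) := by
  classical
  intro N hN e' he'
  rw [coeff_X] at hN
  split_ifs at hN with h
  · rw [h, Finsupp.single_apply] at he'
    split_ifs at he' with h'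
    · exact h' ▸ he
    · exact absurd rfl he'
  · exact absurd rfl hN

theorem pow (hs : SupportedOn A s) (k : ℕ) : SupportedOn A (s ^ k) := by
  induction k with
  | zero => simpa using one
  | succ k ih => rw [pow_succ]; exact ih.mul hs

theorem list_prod {l : List (MvPowerSeries σ ℝ≥0∞)} (h : ∀ s ∈ l, SupportedOn A s) :
    SupportedOn A l.prod := by
  induction l with
  | nil => exact one
  | cons s l ih =>
    rw [List.prod_cons]
    exact (h s (by simp)).mul (ih fun t ht => h t (by simp [ht]))

theorem sum {κ : Type*} {I : Finset κ} {f : κ → MvPowerSeries σ ℝ≥0∞}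
    (h : ∀ i ∈ I, SupportedOn A (f i)) : SupportedOn A (∑ i ∈ I, f i) := by
  intro N hN
  rw [map_sum] at hN
  obtain ⟨i, hi, hne⟩ := Finset.exists_ne_zero_of_sum_ne_zero hN
  exact h i hi N hne

theorem seriesSum {f : ι → MvPowerSeries σ ℝ≥0∞} (h : ∀ i, SupportedOn A (f i)) :
    SupportedOn A (MvPowerSeries.seriesSum f) := by
  intro N hN
  rw [coeff_seriesSum] at hN
  have : ∃ i, coeff N (f i) ≠ 0 := by
    by_contra! h0
    exact hN (by simp [h0])
  obtain ⟨i, hi⟩ := this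
  exact h i N hi

theorem coeff_powerSeries_mul {F G : PowerSeries (MvPowerSeries σ ℝ≥0∞)}
    (hF : ∀ n, SupportedOn A (PowerSeries.coeff n F))
    (hG : ∀ n, SupportedOn A (PowerSeries.coeff n G)) (n : ℕ) :
    SupportedOn A (PowerSeries.coeff n (F * G)) := by
  rw [PowerSeries.coeff_mul]
  exact sum fun p _ => (hF _).mul (hG _)

theorem coeff_powerSeries_pow {F : PowerSeries (MvPowerSeries σ ℝ≥0∞)}
    (hF : ∀ n, SupportedOn A (PowerSeries.coeff n F)) (k n : ℕ) :
    SupportedOn A (PowerSeries.coeff n (F ^ k)) := by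
  induction k generalizing n with
  | zero =>
    rw [pow_zero, PowerSeries.coeff_one]
    split_ifs
    · exact one
    · exact zero
  | succ k ih => rw [pow_succ]; exact coeff_powerSeries_mul ih hF n

end SupportedOn

/-- The part of a power series that has degree `p` in the variable `y` and degree `q` in `r`. -/
noncomputable def bidegPart (y r : σ) (p q : ℕ) (s : MvPowerSeries σ ℝ≥0∞) :
    MvPowerSeries σ ℝ≥0∞ :=
  open Classical in fun N => if N y = p ∧ N r = q then coeff N s else 0

section bidegPart

variable {y r : σ}

open Classical in
theorem coeff_bidegPart (p q : ℕ) (s : MvPowerSeries σ ℝ≥0∞) (N : σ →₀ ℕ) :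
    coeff N (bidegPart y r p q s) = if N y = p ∧ N r = q then coeff N s else 0 := rfl

theorem bidegPart_seriesSum (p q : ℕ) (f : ι → MvPowerSeries σ ℝ≥0∞) :
    bidegPart y r p q (seriesSum f) = seriesSum fun i => bidegPart y r p q (f i) := by
  classical
  ext N
  simp only [coeff_bidegPart, coeff_seriesSum]
  split_ifs
  · rfl
  · simp

/-- Multiplication by a series homogeneous of bidegree `(k, n)` shifts the bidegree, so the
extraction passes to the other factor. -/
theorem bidegPart_mul_of_eq {k n p q : ℕ} {a : MvPowerSeries σ ℝ≥0∞}
    (ha : ∀ N, coeff N a ≠ 0 → N y = k ∧ N r = n) (s : MvPowerSeries σ ℝ≥0∞) :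
    bidegPart y r p q (a * s) =
      if k ≤ p ∧ n ≤ q then a * bidegPart y r (p - k) (q - n) s else 0 := by
  classical
  ext N
  rw [coeff_bidegPart, coeff_mul]
  have key : ∀ x ∈ Finset.HasAntidiagonal.antidiagonal N, coeff x.1 a ≠ 0 →
      (N y = p ∧ N r = q ↔ (k ≤ p ∧ n ≤ q) ∧ x.2 y = p - k ∧ x.2 r = q - n) := by
    intro x hx h
    obtain ⟨h1, h2⟩ := ha _ h
    rw [← Finset.HasAntidiagonal.mem_antidiagonal.1 hx, Finsupp.add_apply, Finsupp.add_apply]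
    omega
  split_ifs with hN hkn hkn
  · rw [coeff_mul]
    refine Finset.sum_congr rfl fun x hx => ?_
    by_cases h : coeff x.1 a = 0
    · simp [h]
    · rw [coeff_bidegPart, if_pos ((key x hx h).1 hN).2]
  · rw [map_zero]
    refine Finset.sum_eq_zero fun x hx => ?_
    by_cases h : coeff x.1 a = 0
    · simp [h]
    · exact absurd ((key x hx h).1 hN).1 hkn
  · rw [coeff_mul]
    refine (Finset.sum_eq_zero fun x hx => ?_).symm
    by_cases h : coeff x.1 a = 0
    · simp [h]
    · rw [coeff_bidegPart, if_neg fun h' => hN ((key x hx h).2 ⟨hkn, h'⟩), mul_zero]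
  · rw [map_zero]

theorem bidegPart_zero_one (q : ℕ) :
    bidegPart y r 0 q (1 : MvPowerSeries σ ℝ≥0∞) = if q = 0 then 1 else 0 := by
  classical
  ext N
  rw [coeff_bidegPart, coeff_one]
  by_cases hN : N = 0
  · subst hN
    by_cases hq : q = 0
    · simp [hq]
    · simp [hq, Ne.symm hq]
  · split_ifs <;> simp [coeff_one, hN]

theorem bidegPart_one_of_pos {p : ℕ} (hp : p ≠ 0) (q : ℕ) :
    bidegPart y r p q (1 : MvPowerSeries σ ℝ≥0∞) = 0 := by
  classical
  ext N
  rw [coeff_bidegPart, coeff_one]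
  by_cases hN : N = 0
  · subst hN
    simp [Ne.symm hp]
  · simp [hN]

theorem bideg_of_coeff_ne_zero (hyr : y ≠ r) {a : MvPowerSeries σ ℝ≥0∞}
    (ha : SupportedOn (fun e => e ≠ y ∧ e ≠ r) a) (k n : ℕ) (N : σ →₀ ℕ)
    (hN : coeff N (X y ^ k * X r ^ n * a) ≠ 0) : N y = k ∧ N r = n := by
  classical
  have h1 : (X y ^ k * X r ^ n : MvPowerSeries σ ℝ≥0∞) =
      monomial (Finsupp.single y k + Finsupp.single r n) 1 := by
    rw [X_pow_eq, X_pow_eq, monomial_mul_monomial, one_mul]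
  rw [h1, coeff_mul] at hN
  obtain ⟨x, hx, hne⟩ := Finset.exists_ne_zero_of_sum_ne_zero hN
  have h2 := left_ne_zero_of_mul hne
  rw [coeff_monomial] at h2
  have h3 : x.1 = Finsupp.single y k + Finsupp.single r n := by
    by_contra h
    simp [h] at h2
  have h4 := ha _ (right_ne_zero_of_mul hne)
  have hy : x.2 y = 0 := by
    by_contra h
    exact (h4 y h).1 rfl
  have hr : x.2 r = 0 := by
    by_contra h
    exact (h4 r h).2 rfl
  rw [← Finset.HasAntidiagonal.mem_antidiagonal.1 hx, h3]
  simp [hy, hr, hyr, hyr.symm]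

end bidegPart

/-- Stands in for division in the Lagrange formula: a nonzero finite scalar cancels coefficientwise,
even against infinite coefficients. -/
theorem natCast_mul_left_cancel {n : ℕ} (hn : n ≠ 0) {a b : MvPowerSeries σ ℝ≥0∞}
    (h : (n : MvPowerSeries σ ℝ≥0∞) * a = (n : MvPowerSeries σ ℝ≥0∞) * b) : a = b := by
  ext N
  have := congrArg (coeff N) h
  rw [← map_natCast (C : ℝ≥0∞ →+* MvPowerSeries σ ℝ≥0∞) n, coeff_C_mul, coeff_C_mul] at this
  exact (ENNReal.mul_right_inj (by simpa using hn) (ENNReal.natCast_ne_top n)).1 this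

end MvPowerSeries

/-! ### Two-type Lagrange inversion -/

namespace PowerSeries

variable {R : Type*} [CommSemiring R]

theorem coeff_X_mul_derivative (F : PowerSeries R) (n : ℕ) :
    coeff n (X * derivative R F) = (n : R) * coeff n F := by
  cases n with
  | zero => simp
  | succ n => rw [coeff_succ_X_mul, coeff_derivative]; push_cast; ring

/-- The coefficient identity behind `(F ^ a)' F ^ b = a / (a + b) (F ^ (a + b))'`. -/
theorem sum_antidiagonal_mul_coeff_pow (F : PowerSeries R) (a b N : ℕ) :
    ((a + b : ℕ) : R) * ∑ x ∈ Finset.HasAntidiagonal.antidiagonal N,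
        (x.1 : R) * coeff x.1 (F ^ a) * coeff x.2 (F ^ b) =
      (a : R) * N * coeff N (F ^ (a + b)) := by
  have h : ((a + b : ℕ) : PowerSeries R) * (X * derivative R (F ^ a) * F ^ b) =
      (a : PowerSeries R) * (X * derivative R (F ^ (a + b))) := by
    cases a with
    | zero => simp
    | succ a =>
      rw [derivative_pow, derivative_pow, show a + 1 + b - 1 = a + b by omega,
        show a + 1 - 1 = a by omega, pow_add]
      push_cast
      ring
  have := congrArg (coeff N) h
  rw [← map_natCast (C : R →+* PowerSeries R), ← map_natCast (C : R →+* PowerSeries R),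
    coeff_C_mul, coeff_C_mul, coeff_X_mul_derivative, coeff_mul] at this
  simp only [coeff_X_mul_derivative] at this
  rw [this, mul_assoc]

end PowerSeries

namespace MvPowerSeries

variable {σ ι κ : Type*}

theorem seriesSum_eq_sum_antidiagonal (q : ℕ) (f : ℕ → MvPowerSeries σ ℝ≥0∞)
    (hf : ∀ n, q < n → f n = 0) :
    seriesSum f = ∑ x ∈ Finset.HasAntidiagonal.antidiagonal q, f x.1 := by
  rw [Finset.Nat.sum_antidiagonal_eq_sum_range_succ_mk]
  ext N
  rw [coeff_seriesSum, map_sum]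
  refine tsum_eq_sum fun n hn => ?_
  rw [hf n (by simpa using hn), map_zero]

section Lagrange

variable {y r : σ} {E F : PowerSeries (MvPowerSeries σ ℝ≥0∞)} {U D : MvPowerSeries σ ℝ≥0∞}

/-- Substituting both equations, one after the other, eliminates `D` and gives a recursion among the
powers of `U` alone. -/
theorem pow_eq_seriesSum (hU : U = X y * sumEval E D) (hD : D = X r * sumEval F U) (k : ℕ) :
    U ^ k = seriesSum fun n => seriesSum fun j =>
      X y ^ k * X r ^ n * (PowerSeries.coeff n (E ^ k) * PowerSeries.coeff j (F ^ n)) * U ^ j := by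
  have hn : ∀ n, D ^ n = X r ^ n * seriesSum fun j => PowerSeries.coeff j (F ^ n) * U ^ j := by
    intro n
    conv_lhs => rw [hD]
    rw [mul_pow, ← sumEval_pow]
    rfl
  conv_lhs => rw [hU]
  rw [mul_pow, ← sumEval_pow, sumEval, mul_seriesSum]
  congr 1
  funext n
  rw [hn, ← mul_assoc, ← mul_assoc, mul_seriesSum]
  congr 1
  funext j
  ring

variable (hyr : y ≠ r)
  (hE : ∀ n, SupportedOn (fun e => e ≠ y ∧ e ≠ r) (PowerSeries.coeff n E))
  (hF : ∀ n, SupportedOn (fun e => e ≠ y ∧ e ≠ r) (PowerSeries.coeff n F))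

include hyr hE hF in
theorem bidegPart_pow_eq_seriesSum (hU : U = X y * sumEval E D) (hD : D = X r * sumEval F U)
    (k p q : ℕ) :
    bidegPart y r p q (U ^ k) = seriesSum fun n => seriesSum fun j =>
      if k ≤ p ∧ n ≤ q then
        X y ^ k * X r ^ n * (PowerSeries.coeff n (E ^ k) * PowerSeries.coeff j (F ^ n)) *
          bidegPart y r (p - k) (q - n) (U ^ j)
      else 0 := by
  conv_lhs => rw [pow_eq_seriesSum hU hD]
  rw [bidegPart_seriesSum]
  congr 1
  funext n
  rw [bidegPart_seriesSum]
  congr 1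
  funext j
  exact bidegPart_mul_of_eq (bideg_of_coeff_ne_zero hyr ((SupportedOn.coeff_powerSeries_pow hE k n).mul
    (SupportedOn.coeff_powerSeries_pow hF n j)) k n) _

-- Each factor `U` carries a factor `y`. This is what makes the sums over powers of `U` finite in a
-- given bidegree.
include hyr hE hF in
theorem bidegPart_pow_of_lt (hU : U = X y * sumEval E D) (hD : D = X r * sumEval F U)
    {k p : ℕ} (hpk : p < k) (q : ℕ) : bidegPart y r p q (U ^ k) = 0 := by
  rw [bidegPart_pow_eq_seriesSum hyr hE hF hU hD]
  simp only [show ¬ k ≤ p by omega, false_and, if_false, seriesSum_zero]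

include hyr hE hF in
/-- Two-type Lagrange inversion. -/
theorem natCast_mul_bidegPart_pow (hU : U = X y * sumEval E D) (hD : D = X r * sumEval F U)
    (p k q : ℕ) (hkp : k ≤ p) :
    (p : MvPowerSeries σ ℝ≥0∞) * bidegPart y r p q (U ^ k) =
      (k : MvPowerSeries σ ℝ≥0∞) * (X y ^ p * X r ^ q *
        (PowerSeries.coeff q (E ^ p) * PowerSeries.coeff (p - k) (F ^ q))) := by
  induction p using Nat.strong_induction_on generalizing k q with
  | _ p ih =>
  rcases Nat.eq_zero_or_pos k with rfl | hk
  · rcases Nat.eq_zero_or_pos p with rfl | hp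
    · simp
    · rw [pow_zero, bidegPart_one_of_pos hp.ne']
      simp
  rw [bidegPart_pow_eq_seriesSum hyr hE hF hU hD]
  -- The recursion lowers the `y`-degree from `p` to `P = p - k`, and `k ≥ 1`, so the induction
  -- hypothesis applies at `P`. It determines the parts only after multiplication by `P`, hence the
  -- separate case `P = 0`.
  obtain ⟨P, rfl⟩ := Nat.exists_eq_add_of_le hkp
  simp only [show k ≤ k + P by omega, true_and, Nat.add_sub_cancel_left]
  rcases Nat.eq_zero_or_pos P with rfl | hP
  -- In `y`-degree 0 only `U ^ 0 = 1` survives, and its `r`-degree 0 forces `n = q`.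
  · rw [seriesSum_eq_single q, seriesSum_eq_single 0]
    · simp [bidegPart_zero_one]
    · intro j hj
      rw [bidegPart_pow_of_lt hyr hE hF hU hD (Nat.pos_of_ne_zero hj)]
      simp
    · intro n hn
      rw [seriesSum_eq_single 0]
      · by_cases h : n ≤ q
        · rw [if_pos h, pow_zero, bidegPart_zero_one, if_neg (by omega), mul_zero]
        · rw [if_neg h]
      · intro j hj
        rw [bidegPart_pow_of_lt hyr hE hF hU hD (Nat.pos_of_ne_zero hj)]
        simp
  have step : (P : MvPowerSeries σ ℝ≥0∞) * (seriesSum fun n => seriesSum fun j =>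
      if n ≤ q then
        X y ^ k * X r ^ n * (PowerSeries.coeff n (E ^ k) * PowerSeries.coeff j (F ^ n)) *
          bidegPart y r P (q - n) (U ^ j)
      else 0) =
      ∑ x ∈ Finset.HasAntidiagonal.antidiagonal q,
        X y ^ (k + P) * X r ^ q *
          (PowerSeries.coeff x.1 (E ^ k) * PowerSeries.coeff x.2 (E ^ P)) *
        ∑ z ∈ Finset.HasAntidiagonal.antidiagonal P,
          (z.1 : MvPowerSeries σ ℝ≥0∞) * PowerSeries.coeff z.1 (F ^ x.1) *
            PowerSeries.coeff z.2 (F ^ x.2) := by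
    -- Both sums are finite: `n ≤ q` by the degree in `r`, and `j ≤ P` by the degree of `U ^ j` in
    -- `y`.
    rw [mul_seriesSum, seriesSum_eq_sum_antidiagonal q]
    · refine Finset.sum_congr rfl fun x hx => ?_
      have hx' := Finset.HasAntidiagonal.mem_antidiagonal.1 hx
      rw [mul_seriesSum, seriesSum_eq_sum_antidiagonal P, Finset.mul_sum]
      · refine Finset.sum_congr rfl fun z hz => ?_
        have hz' := Finset.HasAntidiagonal.mem_antidiagonal.1 hz
        rw [if_pos (by omega), mul_left_comm, ih P (by omega) z.1 (q - x.1) (by omega),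
          show q - x.1 = x.2 by omega, show P - z.1 = z.2 by omega, ← hx', pow_add, pow_add]
        ring
      · intro j hj
        rw [bidegPart_pow_of_lt hyr hE hF hU hD hj]
        simp
    · intro n hn
      simp [show ¬ n ≤ q by omega, seriesSum_zero]
  rcases Nat.eq_zero_or_pos q with rfl | hq
  -- For `q = 0` there is no factor `q` to cancel. Both sides vanish: `F ^ 0 = 1` has only a
  -- constant coefficient, which on the left has weight 0 and on the right is not the one of index
  -- `P > 0`.
  · have h0 : (P : MvPowerSeries σ ℝ≥0∞) * (seriesSum fun n => seriesSum fun j =>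
        if n ≤ 0 then
          X y ^ k * X r ^ n * (PowerSeries.coeff n (E ^ k) * PowerSeries.coeff j (F ^ n)) *
            bidegPart y r P (0 - n) (U ^ j)
        else 0) = (P : MvPowerSeries σ ℝ≥0∞) * 0 := by
      rw [step, mul_zero]
      simp only [Finset.HasAntidiagonal.antidiagonal_zero, Finset.sum_singleton, pow_zero]
      rw [Finset.sum_eq_zero, mul_zero]
      intro z _
      rcases Nat.eq_zero_or_pos z.1 with h | h
      · simp [h]
      · simp [PowerSeries.coeff_one, h.ne']
    rw [natCast_mul_left_cancel hP.ne' h0]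
    simp [PowerSeries.coeff_one, hP.ne']
  -- The derivative identity for `F`, with exponents `n` and `q - n`, sums over `j` and produces a
  -- factor `n`; the identity for `E`, with exponents `k` and `P`, uses that factor to sum over `n`.
  · refine natCast_mul_left_cancel (mul_pos hq hP).ne' ?_
    rw [mul_left_comm, Nat.cast_mul, mul_assoc, step, Finset.mul_sum]
    have h1 : ∀ x ∈ Finset.HasAntidiagonal.antidiagonal q,
        (q : MvPowerSeries σ ℝ≥0∞) * (X y ^ (k + P) * X r ^ q *
          (PowerSeries.coeff x.1 (E ^ k) * PowerSeries.coeff x.2 (E ^ P)) *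
        ∑ z ∈ Finset.HasAntidiagonal.antidiagonal P,
          (z.1 : MvPowerSeries σ ℝ≥0∞) * PowerSeries.coeff z.1 (F ^ x.1) *
            PowerSeries.coeff z.2 (F ^ x.2)) =
        X y ^ (k + P) * X r ^ q * (P : MvPowerSeries σ ℝ≥0∞) * PowerSeries.coeff P (F ^ q) *
          ((x.1 : MvPowerSeries σ ℝ≥0∞) * PowerSeries.coeff x.1 (E ^ k) *
            PowerSeries.coeff x.2 (E ^ P)) := by
      intro x hx
      have hx' := Finset.HasAntidiagonal.mem_antidiagonal.1 hx
      have := PowerSeries.sum_antidiagonal_mul_coeff_pow F x.1 x.2 P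
      rw [hx'] at this
      rw [mul_left_comm, this]
      ring
    rw [Finset.sum_congr rfl h1, ← Finset.mul_sum, mul_left_comm,
      PowerSeries.sum_antidiagonal_mul_coeff_pow E k P q]
    ring

include hyr hE hF in
/-- In the bidegree `(p, q)` part of `G(U)`, the series `E` contributes only the factor
`[x ^ q] E(x) ^ p`. -/
theorem exists_bidegPart_sumEval_eq {A : σ → Prop} {G : PowerSeries (MvPowerSeries σ ℝ≥0∞)}
    (hU : U = X y * sumEval E D) (hD : D = X r * sumEval F U)
    (hG : ∀ n, SupportedOn (fun e => e ≠ y ∧ e ≠ r) (PowerSeries.coeff n G))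
    (hFA : ∀ n, SupportedOn A (PowerSeries.coeff n F))
    (hGA : ∀ n, SupportedOn A (PowerSeries.coeff n G)) (p q : ℕ) :
    ∃ L, SupportedOn A L ∧ bidegPart y r p q (sumEval G U) =
      X y ^ p * X r ^ q * PowerSeries.coeff q (E ^ p) * L := by
  have h1 : bidegPart y r p q (sumEval G U) = ∑ x ∈ Finset.HasAntidiagonal.antidiagonal p,
      PowerSeries.coeff x.1 G * bidegPart y r p q (U ^ x.1) := by
    rw [sumEval, bidegPart_seriesSum, seriesSum_eq_sum_antidiagonal p]
    · refine Finset.sum_congr rfl fun x _ => ?_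
      have := bideg_of_coeff_ne_zero hyr (hG x.1) 0 0
      simp only [pow_zero, one_mul] at this
      rw [bidegPart_mul_of_eq this]
      simp
    · intro n hn
      have := bideg_of_coeff_ne_zero hyr (hG n) 0 0
      simp only [pow_zero, one_mul] at this
      rw [bidegPart_mul_of_eq this]
      simp [bidegPart_pow_of_lt hyr hE hF hU hD hn]
  rcases Nat.eq_zero_or_pos p with rfl | hp
  · refine ⟨PowerSeries.coeff 0 G, hGA 0, ?_⟩
    rw [h1]
    simp only [Finset.HasAntidiagonal.antidiagonal_zero, Finset.sum_singleton, pow_zero, bidegPart_zero_one,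
      PowerSeries.coeff_one]
    split_ifs with hq
    · simp [hq]
    · simp
  -- The witness is `(1 / p) ∑ i [z^i]G [z^(p-i)]F^q`, obtained by expanding `G(U)` in powers of `U`
  -- and applying Lagrange inversion to each power.
  · refine ⟨C (p : ℝ≥0∞)⁻¹ * ∑ x ∈ Finset.HasAntidiagonal.antidiagonal p,
      PowerSeries.coeff x.1 G * ((x.1 : MvPowerSeries σ ℝ≥0∞) * PowerSeries.coeff x.2 (F ^ q)),
      (SupportedOn.C _).mul (SupportedOn.sum fun x _ => (hGA _).mul ((SupportedOn.natCast _).mul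
        (SupportedOn.coeff_powerSeries_pow hFA _ _))), ?_⟩
    have hpC : (p : MvPowerSeries σ ℝ≥0∞) * C (p : ℝ≥0∞)⁻¹ = 1 := by
      rw [← map_natCast (C : ℝ≥0∞ →+* MvPowerSeries σ ℝ≥0∞) p, ← map_mul,
        ENNReal.mul_inv_cancel (by simpa using hp.ne') (ENNReal.natCast_ne_top p), map_one]
    refine natCast_mul_left_cancel hp.ne' ?_
    rw [h1, Finset.mul_sum, mul_left_comm, ← mul_assoc (p : MvPowerSeries σ ℝ≥0∞), hpC, one_mul,
      Finset.mul_sum]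
    refine Finset.sum_congr rfl fun x hx => ?_
    have hx' := Finset.HasAntidiagonal.mem_antidiagonal.1 hx
    rw [mul_left_comm, natCast_mul_bidegPart_pow hyr hE hF hU hD p x.1 q (by omega),
      show p - x.1 = x.2 by omega]
    ring

end Lagrange

/-! ### Weighted sums of coefficients and powers as sums over tuples -/

section coeffPairing

/-- The sum of the coefficients of a power series, weighted by `g`. -/
noncomputable def coeffPairing (g : (σ →₀ ℕ) → ℝ≥0∞) (s : MvPowerSeries σ ℝ≥0∞) : ℝ≥0∞ :=
  ∑' N, coeff N s * g N

theorem coeffPairing_seriesSum (g : (σ →₀ ℕ) → ℝ≥0∞) (f : ι → MvPowerSeries σ ℝ≥0∞) :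
    coeffPairing g (seriesSum f) = ∑' i, coeffPairing g (f i) := by
  simp only [coeffPairing, coeff_seriesSum, ← ENNReal.tsum_mul_right]
  exact ENNReal.tsum_comm

theorem coeffPairing_monomial (g : (σ →₀ ℕ) → ℝ≥0∞) (N : σ →₀ ℕ) (a : ℝ≥0∞) :
    coeffPairing g (monomial N a) = a * g N := by
  classical
  rw [coeffPairing, tsum_eq_single N]
  · simp
  · intro N' h
    rw [coeff_monomial, if_neg h, zero_mul]

theorem coeffPairing_zero (g : (σ →₀ ℕ) → ℝ≥0∞) : coeffPairing g 0 = 0 := by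
  simp [coeffPairing]

/-- Turns a factorization of generating series into a product of masses. The weight has to split
only on pairs of monomials that actually occur, which is where support information enters. -/
theorem coeffPairing_mul {g g₁ g₂ : (σ →₀ ℕ) → ℝ≥0∞} {s t : MvPowerSeries σ ℝ≥0∞}
    (hg : ∀ N₁ N₂, coeff N₁ s ≠ 0 → coeff N₂ t ≠ 0 → g (N₁ + N₂) = g₁ N₁ * g₂ N₂) :
    coeffPairing g (s * t) = coeffPairing g₁ s * coeffPairing g₂ t := by
  classical
  have h1 : coeffPairing g (s * t) =
      ∑' p : (σ →₀ ℕ) × (σ →₀ ℕ), coeff p.1 s * coeff p.2 t * g (p.1 + p.2) := by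
    rw [coeffPairing, ← Finset.HasAntidiagonal.sigmaAntidiagonalEquivProd.tsum_eq,
      ENNReal.tsum_sigma']
    congr 1
    funext N
    rw [coeff_mul, Finset.sum_mul, ← Finset.tsum_subtype]
    congr 1
    funext p
    have := Finset.HasAntidiagonal.mem_antidiagonal.1 p.2
    simp [this]
  rw [h1, ENNReal.tsum_prod']
  simp only [coeffPairing, ← ENNReal.tsum_mul_right]
  congr 1
  funext N₁
  rw [← ENNReal.tsum_mul_left]
  congr 1
  funext N₂
  by_cases h₁ : coeff N₁ s = 0
  · simp [h₁]
  by_cases h₂ : coeff N₂ t = 0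
  · simp [h₂]
  rw [hg N₁ N₂ h₁ h₂]
  ring

theorem coeffPairing_one_mul (s t : MvPowerSeries σ ℝ≥0∞) :
    coeffPairing (fun _ => 1) (s * t) =
      coeffPairing (fun _ => 1) s * coeffPairing (fun _ => 1) t :=
  coeffPairing_mul fun _ _ _ _ => by simp

theorem coeffPairing_one_pow (s : MvPowerSeries σ ℝ≥0∞) (n : ℕ) :
    coeffPairing (fun _ => 1) (s ^ n) = coeffPairing (fun _ => 1) s ^ n := by
  induction n with
  | zero =>
    rw [pow_zero, pow_zero, ← map_one (C : ℝ≥0∞ →+* MvPowerSeries σ ℝ≥0∞),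
      ← monomial_zero_eq_C_apply, coeffPairing_monomial, one_mul]
  | succ n ih => rw [pow_succ, coeffPairing_one_mul, ih, pow_succ]

end coeffPairing

theorem sum_seriesSum (I : Finset κ) (f : κ → ι → MvPowerSeries σ ℝ≥0∞) :
    ∑ x ∈ I, seriesSum (f x) = seriesSum fun i => ∑ x ∈ I, f x i := by
  ext N
  simp only [map_sum, coeff_seriesSum]
  rw [Summable.tsum_finsetSum fun _ _ => ENNReal.summable]

/-- The coefficients of the powers of a generating series are sums over tuples. -/
theorem coeff_pow_eq_seriesSum {E : PowerSeries (MvPowerSeries σ ℝ≥0∞)} {z : ι → ℕ}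
    {f : ι → MvPowerSeries σ ℝ≥0∞}
    (hE : ∀ n, PowerSeries.coeff n E = seriesSum fun i => if z i = n then f i else 0) (p q : ℕ) :
    PowerSeries.coeff q (E ^ p) =
      seriesSum fun τ : Fin p → ι => if ∑ k, z (τ k) = q then ∏ k, f (τ k) else 0 := by
  induction p generalizing q with
  | zero =>
    rw [seriesSum_eq_single (fun i => i.elim0)]
    · simp [PowerSeries.coeff_one, eq_comm]
    · intro j hj
      exact absurd (Subsingleton.elim _ _) hj
  | succ p ih =>
    rw [← seriesSum_equiv (Fin.consEquiv fun _ => ι), pow_succ', PowerSeries.coeff_mul]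
    simp only [hE, ih, seriesSum_mul, mul_seriesSum, sum_seriesSum, Fin.consEquiv_apply,
      Fin.sum_univ_succ, Fin.prod_univ_succ, Fin.cons_zero, Fin.cons_succ]
    rw [seriesSum_prod fun i (τ : Fin p → ι) => if z i + ∑ k, z (τ k) = q then
      f i * ∏ k, f (τ k) else 0, seriesSum_comm]
    congr 1
    funext i
    congr 1
    funext τ
    split_ifs with h
    · rw [Finset.sum_eq_single (z i, ∑ k, z (τ k))]
      · simp
      · rintro ⟨a, b⟩ _ hne
        by_cases ha : z i = a
        · rw [if_neg (c := _ = b), mul_zero]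
          rintro rfl
          exact hne (by rw [ha])
        · rw [if_neg (c := _ = a) ha, zero_mul]
      · intro hn
        exact absurd (Finset.HasAntidiagonal.mem_antidiagonal.2 h) hn
    · refine Finset.sum_eq_zero fun x hx => ?_
      have hx' := Finset.HasAntidiagonal.mem_antidiagonal.1 hx
      by_cases ha : z i = x.1
      · rw [if_neg (c := _ = x.2), mul_zero]
        intro hb
        exact h (by rw [ha, hb, hx'])
      · rw [if_neg (c := _ = x.1) ha, zero_mul]

end MvPowerSeries

namespace MvPowerSeries

variable {σ ι κ : Type*}

theorem seriesSum_eq_zero {f : ι → MvPowerSeries σ ℝ≥0∞} (h : ∀ i, f i = 0) :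
    seriesSum f = 0 := by
  rw [show f = fun _ => 0 from funext h, seriesSum_zero]

theorem seriesSum_list (f : List ι → MvPowerSeries σ ℝ≥0∞) :
    seriesSum f = f [] + seriesSum fun a => seriesSum fun l => f (a :: l) := by
  let e : Unit ⊕ (ι × List ι) ≃ List ι :=
    { toFun := Sum.elim (fun _ => []) fun p => p.1 :: p.2
      invFun := fun l => l.casesOn (Sum.inl ()) fun a l => Sum.inr (a, l)
      left_inv := by rintro (_ | ⟨a, l⟩) <;> rfl
      right_inv := by rintro (_ | ⟨a, l⟩) <;> rfl }
  rw [← seriesSum_equiv e, ← seriesSum_prod]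
  ext N
  rw [coeff_seriesSum, map_add, coeff_seriesSum]
  rw [Summable.tsum_sum ENNReal.summable ENNReal.summable, tsum_fintype (L := .unconditional Unit),
    Fintype.sum_unique]
  rfl

-- Distributivity: fixing the type of each entry makes the positions of the list independent.
-- Applied to lists of subtrees, this is the branching property.
open Classical in
theorem seriesSum_list_fiber (h : ι → κ) (f : ι → MvPowerSeries σ ℝ≥0∞) (ls : List κ) :
    (seriesSum fun cs : List ι => if cs.map h = ls then (cs.map f).prod else 0) =
      (ls.map fun b => seriesSum fun i => if h i = b then f i else 0).prod := by
  induction ls with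
  | nil =>
    rw [seriesSum_list]
    simp [seriesSum_zero]
  | cons b ls ih =>
    rw [seriesSum_list, List.map_cons, List.prod_cons, ← ih, seriesSum_mul]
    simp only [List.map_nil, reduceCtorEq, if_false, zero_add, List.map_cons, List.cons.injEq,
      List.prod_cons, mul_seriesSum]
    congr 1
    funext a
    congr 1
    funext l
    split_ifs <;> simp_all

end MvPowerSeries

/-! ### Generating series of labelled trees and of their truncations -/

namespace LTree

open MvPowerSeries

variable (ξ : PMF ℕ) (η : (k : ℕ) → PMF (Fin k → ℤ))

theorem induct {P : LTree → Prop} (h : ∀ a cs, (∀ c ∈ cs, P c) → P (node a cs)) (t : LTree) : P t :=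
  edges.induct P h t

/-- A labelled tree is its root label together with the list of its subtrees. -/
def equivProd : LTree ≃ ℤ × List LTree where
  toFun t := t.casesOn fun a cs => (a, cs)
  invFun p := node p.1 p.2
  left_inv := by rintro ⟨a, cs⟩; rfl
  right_inv _ := rfl

theorem seriesSum_eq {σ : Type*} (f : LTree → MvPowerSeries σ ℝ≥0∞) :
    seriesSum f = seriesSum fun a => seriesSum fun cs => f (node a cs) := by
  rw [← seriesSum_equiv equivProd.symm, ← seriesSum_prod]
  rfl

/-- The probability that a vertex labelled `a` has children with labels `ls`. -/
noncomputable def childFactor (a : ℤ) (ls : List ℤ) : ℝ≥0∞ :=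
  ξ ls.length * η ls.length fun i => ls.get i - a

/-- The type of a displacement vector depends on the number of children, so equal lengths have to be
transported before vectors can be compared. -/
theorem offspring_mul_displacement_congr {k k' : ℕ} (hk : k = k') (e : Fin k → ℤ)
    (e' : Fin k' → ℤ) (h : ∀ i, e i = e' (Fin.cast hk i)) : ξ k * η k e = ξ k' * η k' e' := by
  subst hk
  rw [show e = e' from funext h]

theorem childFactor_map_rootLabel (a : ℤ) (cs : List LTree) :
    childFactor ξ η a (cs.map rootLabel) =
      ξ cs.length * η cs.length fun i => (cs.get i).rootLabel - a :=
  offspring_mul_displacement_congr ξ η (by simp) _ _ fun i => by simp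

theorem childFactor_ofFn (a : ℤ) {k : ℕ} (e : Fin k → ℤ) :
    childFactor ξ η a (List.ofFn e) = ξ k * η k fun i => e i - a :=
  offspring_mul_displacement_congr ξ η (by simp) _ _ fun i => by
    rw [List.get_ofFn]

theorem childFactor_map_add (a b : ℤ) (ls : List ℤ) :
    childFactor ξ η (a + b) (ls.map (· + b)) = childFactor ξ η a ls :=
  offspring_mul_displacement_congr ξ η (by simp) _ _ fun i => by simp

theorem weight_node (a : ℤ) (cs : List LTree) :
    (node a cs).weight ξ η =
      childFactor ξ η a (cs.map rootLabel) * (cs.map fun c => c.weight ξ η).prod := by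
  rw [childFactor_map_rootLabel, weight]

/-- The weight of a truncated tree: leaves labelled `l` carry no offspring factor. -/
noncomputable def truncWeight (l : ℤ) : LTree → ℝ≥0∞
  | node a cs => if a = l then (if cs = [] then 1 else 0) else
    childFactor ξ η a (cs.map rootLabel) * (cs.map fun c => c.truncWeight l).prod

theorem truncWeight_node (l a : ℤ) (cs : List LTree) :
    (node a cs).truncWeight ξ η l = if a = l then (if cs = [] then 1 else 0) else
      childFactor ξ η a (cs.map rootLabel) * (cs.map fun c => c.truncWeight ξ η l).prod := by
  rw [truncWeight]

/-- The product of the variables attached to the edges. -/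
noncomputable def edgeMonomial (t : LTree) : MvPowerSeries (ℤ × ℤ) ℝ≥0∞ :=
  (t.edges.map X).prod

theorem edgeMonomial_node (a : ℤ) (cs : List LTree) :
    (node a cs).edgeMonomial =
      (cs.map fun c => X (a, c.rootLabel) * c.edgeMonomial).prod := by
  rw [edgeMonomial, edges]
  induction cs with
  | nil => simp
  | cons c cs ih =>
    rw [List.flatMap_cons, List.map_append, List.prod_append, ih]
    simp [edgeMonomial]

/-- The monomial of the edges of a tree, with the weight of the tree as coefficient. -/
noncomputable def edgeSeries (t : LTree) : MvPowerSeries (ℤ × ℤ) ℝ≥0∞ :=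
  C (t.weight ξ η) * t.edgeMonomial

theorem edgeSeries_node (a : ℤ) (cs : List LTree) :
    (node a cs).edgeSeries ξ η = C (childFactor ξ η a (cs.map rootLabel)) *
      (cs.map fun c => X (a, c.rootLabel) * c.edgeSeries ξ η).prod := by
  rw [edgeSeries, weight_node, edgeMonomial_node, map_mul, mul_assoc]
  congr 1
  induction cs with
  | nil => simp
  | cons c cs ih =>
    simp only [List.map_cons, List.prod_cons, map_mul]
    rw [← ih, edgeSeries]
    ring

/-- The generating series of the labelled trees with root label `x`. -/
noncomputable def rootSeries (x : ℤ) : MvPowerSeries (ℤ × ℤ) ℝ≥0∞ :=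
  seriesSum fun t : LTree => if t.rootLabel = x then t.edgeSeries ξ η else 0

theorem rootSeries_eq_seriesSum_list (x : ℤ) :
    rootSeries ξ η x = seriesSum fun cs => (node x cs).edgeSeries ξ η := by
  rw [rootSeries, seriesSum_eq]
  have : ∀ a, (seriesSum fun cs => if (node a cs).rootLabel = x then
      (node a cs).edgeSeries ξ η else 0) =
      if x = a then seriesSum fun cs => (node a cs).edgeSeries ξ η else 0 := by
    intro a
    by_cases h : x = a
    · simp [rootLabel, h]
    · simp [rootLabel, h, Ne.symm h, seriesSum_zero]
  simp only [this]
  rw [seriesSum_ite_eq]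

/-- The monomial of the edges of a truncated tree, with its weight as coefficient. -/
noncomputable def truncSeries (l : ℤ) (t : LTree) : MvPowerSeries (ℤ × ℤ) ℝ≥0∞ :=
  C (t.truncWeight ξ η l) * t.edgeMonomial

theorem truncSeries_node {l a : ℤ} (h : a ≠ l) (cs : List LTree) :
    (node a cs).truncSeries ξ η l = C (childFactor ξ η a (cs.map rootLabel)) *
      (cs.map fun c => X (a, c.rootLabel) * c.truncSeries ξ η l).prod := by
  rw [truncSeries, truncWeight_node, if_neg h, edgeMonomial_node, map_mul, mul_assoc]
  congr 1
  induction cs with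
  | nil => simp
  | cons c cs ih =>
    simp only [List.map_cons, List.prod_cons, map_mul]
    rw [← ih, truncSeries]
    ring

theorem rootLabel_trunc (l : ℤ) (t : LTree) : (t.trunc l).rootLabel = t.rootLabel := by
  cases t
  rw [trunc]
  rfl

open Classical in
/-- The trees with a given truncation are obtained by grafting a tree at each leaf labelled `l`. -/
theorem seriesSum_trunc_fiber (l : ℤ) (τ : LTree) :
    (seriesSum fun t : LTree => if t.trunc l = τ then t.edgeSeries ξ η else 0) =
      τ.truncSeries ξ η l * rootSeries ξ η l ^ τ.labels.count l := by
  induction τ using induct with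
  | h a cs' ih =>
  have h1 : (seriesSum fun t : LTree => if t.trunc l = node a cs' then t.edgeSeries ξ η else 0) =
      seriesSum fun cs => if (if a = l then [] else cs.map (trunc l)) = cs' then
        (node a cs).edgeSeries ξ η else 0 := by
    rw [seriesSum_eq, seriesSum_eq_single a]
    · simp only [trunc, node.injEq, true_and]
    · intro b hb
      simp only [trunc, node.injEq, hb, false_and, if_false, seriesSum_zero]
  rw [h1]
  -- At a vertex labelled `l` the truncation forgets all descendants, so the fiber is the set of all
  -- trees rooted there. At any other vertex the fibers of the children multiply.
  by_cases ha : a = l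
  · subst ha
    simp only [if_true]
    by_cases hcs : cs' = []
    · subst hcs
      simp only [if_true, truncSeries, truncWeight_node, labels, edgeMonomial_node,
        rootSeries_eq_seriesSum_list]
      simp
    · simp [Ne.symm hcs, hcs, truncSeries, truncWeight_node, seriesSum_zero]
  · simp only [if_neg ha]
    have h2 : ∀ cs : List LTree, (if cs.map (trunc l) = cs' then (node a cs).edgeSeries ξ η else 0) =
        C (childFactor ξ η a (cs'.map rootLabel)) * if cs.map (trunc l) = cs' then
          (cs.map fun c => X (a, c.rootLabel) * c.edgeSeries ξ η).prod else 0 := by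
      intro cs
      split_ifs with h
      · rw [edgeSeries_node, ← h, List.map_map]
        simp only [Function.comp_def, rootLabel_trunc]
      · simp
    simp only [h2]
    rw [← mul_seriesSum, seriesSum_list_fiber, truncSeries_node ξ η ha, mul_assoc]
    congr 1
    have h3 : ∀ b ∈ cs', (seriesSum fun c : LTree => if c.trunc l = b then
        X (a, c.rootLabel) * c.edgeSeries ξ η else 0) =
        X (a, b.rootLabel) * b.truncSeries ξ η l * rootSeries ξ η l ^ b.labels.count l := by
      intro b hb
      rw [mul_assoc, ← ih b hb, mul_seriesSum]
      congr 1
      funext c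
      split_ifs with h
      · rw [← h, rootLabel_trunc]
      · simp
    rw [List.map_congr_left h3, labels, List.count_cons_of_ne ha, List.count_flatMap]
    clear h1 h2 h3 ih
    induction cs' with
    | nil => simp
    | cons c cs ih =>
      simp only [List.map_cons, List.prod_cons, ih, List.sum_cons, pow_add, Function.comp_apply]
      ring

section Side

variable {ξ η} {S : ℤ → Prop} {u l : ℤ}

theorem childFactor_ne_zero
    (hη : ∀ (k : ℕ) (e : Fin k → ℤ), η k e ≠ 0 → ∀ i, e i = -1 ∨ e i = 0 ∨ e i = 1)
    {a : ℤ} {ls : List ℤ} (h : childFactor ξ η a ls ≠ 0) {b : ℤ} (hb : b ∈ ls) :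
    b - a = -1 ∨ b - a = 0 ∨ b - a = 1 := by
  obtain ⟨i, rfl⟩ := List.get_of_mem hb
  exact hη _ _ (right_ne_zero_of_mul h) i

variable (hη : ∀ (k : ℕ) (e : Fin k → ℤ), η k e ≠ 0 → ∀ i, e i = -1 ∨ e i = 0 ∨ e i = 1)
  (hS : ∀ a b, S a → (b - a = -1 ∨ b - a = 0 ∨ b - a = 1) → S b ∨ (a = u ∧ b = l))
  (hl : ¬ S l)

include hη hS hl in
/-- A tree started on the side `S` of the level `l` and truncated at `l` has its edges in `S`,
apart from the edges `(u, l)` leading to its leaves labelled `l`. -/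
theorem edges_of_truncWeight_ne_zero (τ : LTree) (hτ : τ.truncWeight ξ η l ≠ 0)
    (hr : S τ.rootLabel ∨ τ.rootLabel = l) :
    (∀ e ∈ τ.edges, (S e.1 ∧ S e.2) ∨ e = (u, l)) ∧
      τ.labels.count l = τ.edges.count (u, l) + if τ.rootLabel = l then 1 else 0 := by
  induction τ using induct with
  | h a cs ih =>
  rw [truncWeight_node] at hτ
  by_cases ha : a = l
  · subst ha
    rw [if_pos rfl] at hτ
    have hcs : cs = [] := by
      by_contra h
      simp [h] at hτ
    subst hcs
    simp [edges, labels, rootLabel]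
  · rw [if_neg ha] at hτ
    have hSa : S a := hr.resolve_right ha
    have hc : ∀ c ∈ cs, S c.rootLabel ∨ (a = u ∧ c.rootLabel = l) := fun c hc =>
      hS a _ hSa (childFactor_ne_zero hη (left_ne_zero_of_mul hτ) (List.mem_map_of_mem hc))
    have hw : ∀ c ∈ cs, c.truncWeight ξ η l ≠ 0 := by
      intro c hc h0
      exact right_ne_zero_of_mul hτ (List.prod_eq_zero (by
        rw [← h0]
        exact List.mem_map_of_mem (f := fun c => c.truncWeight ξ η l) hc))
    have ih' := fun c hcm => ih c hcm (hw c hcm) ((hc c hcm).imp_right And.right)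
    constructor
    · intro e he
      rw [edges, List.mem_flatMap] at he
      obtain ⟨c, hcm, he⟩ := he
      rcases List.mem_cons.1 he with rfl | he
      · rcases hc c hcm with h | ⟨rfl, h⟩
        · exact Or.inl ⟨hSa, h⟩
        · exact Or.inr (by rw [h])
      · exact (ih' c hcm).1 e he
    · rw [labels, edges, List.count_cons_of_ne ha, List.count_flatMap, List.count_flatMap]
      rw [if_neg (show ¬ (node a cs).rootLabel = l from ha), add_zero]
      congr 1
      refine List.map_congr_left fun c hcm => ?_
      simp only [Function.comp_apply]
      rw [(ih' c hcm).2, List.count_cons]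
      congr 1
      rcases hc c hcm with h | ⟨rfl, h⟩
      · have : c.rootLabel ≠ l := by
          rintro h'
          exact hl (h' ▸ h)
        simp [this]
      · simp [h]

end Side

/-- The monomial of the edges other than `(u, l)` of a tree truncated at `l`, with its weight. -/
noncomputable def coreSeries (u l : ℤ) (t : LTree) : MvPowerSeries (ℤ × ℤ) ℝ≥0∞ :=
  C (t.truncWeight ξ η l) * ((t.edges.filter fun e => e ≠ (u, l)).map X).prod

theorem truncSeries_eq_coreSeries_mul (u l : ℤ) (t : LTree) :
    t.truncSeries ξ η l = t.coreSeries ξ η u l * X (u, l) ^ t.edges.count (u, l) := by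
  rw [truncSeries, coreSeries, edgeMonomial, mul_assoc]
  congr 1
  induction t.edges with
  | nil => simp
  | cons e es ih =>
    by_cases h : e = (u, l)
    · simp [h, ih, pow_succ]
      ring
    · simp [h, ih, mul_assoc]

open Classical in
/-- The generating series, in the number of leaves labelled `l`, of the truncations at `l` of the
trees with root label `x`. -/
noncomputable def truncGenSeries (u l x : ℤ) : PowerSeries (MvPowerSeries (ℤ × ℤ) ℝ≥0∞) :=
  PowerSeries.mk fun n => seriesSum fun t : LTree =>
    if t.labels.count l = n then (if t.rootLabel = x then t.coreSeries ξ η u l else 0) else 0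

theorem coeff_truncGenSeries (u l x : ℤ) (n : ℕ) :
    PowerSeries.coeff n (truncGenSeries ξ η u l x) = seriesSum fun t : LTree =>
      if t.labels.count l = n then (if t.rootLabel = x then t.coreSeries ξ η u l else 0) else 0 := by
  rw [truncGenSeries, PowerSeries.coeff_mk]

section Side

variable {ξ η} {S : ℤ → Prop} {u l x : ℤ}
  (hη : ∀ (k : ℕ) (e : Fin k → ℤ), η k e ≠ 0 → ∀ i, e i = -1 ∨ e i = 0 ∨ e i = 1)
  (hS : ∀ a b, S a → (b - a = -1 ∨ b - a = 0 ∨ b - a = 1) → S b ∨ (a = u ∧ b = l))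
  (hl : ¬ S l) (hx : S x)

-- The root is not labelled `l`, so each leaf labelled `l` hangs from its own edge `(u, l)`; the
-- power restores the edges left out of `coreSeries`.
include hη hS hl in
theorem truncSeries_eq_coreSeries_mul_pow (τ : LTree) (hτ : S τ.rootLabel) :
    τ.truncSeries ξ η l = τ.coreSeries ξ η u l * X (u, l) ^ τ.labels.count l := by
  by_cases h0 : τ.truncWeight ξ η l = 0
  · simp [truncSeries, coreSeries, h0]
  · have hne : τ.rootLabel ≠ l := fun h => hl (h ▸ hτ)
    rw [truncSeries_eq_coreSeries_mul, (edges_of_truncWeight_ne_zero hη hS hl τ h0 (Or.inl hτ)).2,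
      if_neg hne, add_zero]

-- Trees are grouped by their truncation. Each leaf labelled `l` contributes the edge `(u, l)`
-- leading to it and an arbitrary tree grafted on it. Used above and below the cut, this gives the
-- system solved by Lagrange inversion.
include hη hS hl hx in
theorem rootSeries_eq_sumEval :
    rootSeries ξ η x = sumEval (truncGenSeries ξ η u l x) (X (u, l) * rootSeries ξ η l) := by
  classical
  simp only [sumEval, coeff_truncGenSeries, seriesSum_mul]
  rw [rootSeries, seriesSum_fiber (trunc l), seriesSum_comm (ι := ℕ)]
  congr 1
  funext τ
  rw [seriesSum_eq_single (τ.labels.count l)]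
  · rw [if_pos rfl]
    by_cases hτ : τ.rootLabel = x
    · rw [if_pos hτ, mul_pow, ← mul_assoc,
        ← truncSeries_eq_coreSeries_mul_pow hη hS hl τ (hτ ▸ hx), ← seriesSum_trunc_fiber]
      congr 1
      funext t
      split_ifs with h1 h2
      · rfl
      · exact absurd (by rw [← rootLabel_trunc l t, h1, hτ]) h2
      · rfl
    · rw [if_neg hτ, zero_mul]
      refine seriesSum_eq_zero fun t => ?_
      split_ifs with h1 h2
      · exact absurd (by rw [← h1, rootLabel_trunc, h2]) hτ
      · rfl
      · rfl
  · intro n hn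
    rw [if_neg hn.symm, zero_mul]

include hη hS hl hx in
theorem supportedOn_coeff_truncGenSeries (n : ℕ) :
    SupportedOn (fun e => S e.1 ∧ S e.2) (PowerSeries.coeff n (truncGenSeries ξ η u l x)) := by
  rw [coeff_truncGenSeries]
  refine SupportedOn.seriesSum fun τ => ?_
  split_ifs with h1 h2
  · by_cases h0 : τ.truncWeight ξ η l = 0
    · simp only [coreSeries, h0, map_zero, zero_mul]
      exact SupportedOn.zero
    · refine (SupportedOn.C _).mul (SupportedOn.list_prod fun s hs => ?_)
      obtain ⟨e, he, rfl⟩ := List.mem_map.1 hs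
      rw [List.mem_filter] at he
      have := (edges_of_truncWeight_ne_zero hη hS hl τ h0 (Or.inl (h2 ▸ hx))).1 e he.1
      exact SupportedOn.X (this.resolve_right (by simpa using he.2))
  · exact SupportedOn.zero
  · exact SupportedOn.zero

end Side

end LTree

/-! ### Countability of trees and total mass of the laws -/

namespace LTree

open MvPowerSeries

/-- The number of vertices. -/
def card : LTree → ℕ
  | node _ cs => (cs.map fun c => c.card).sum + 1

theorem card_lt_card_node {a : ℤ} {cs : List LTree} {c : LTree} (hc : c ∈ cs) :
    c.card < (node a cs).card := by
  rw [card.eq_1 a cs, Nat.lt_succ_iff]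
  exact List.single_le_sum (fun _ _ => Nat.zero_le _) _ (List.mem_map_of_mem hc)

theorem countable_card_le (n : ℕ) : {t : LTree | t.card ≤ n}.Countable := by
  induction n with
  | zero =>
    convert Set.countable_empty
    ext ⟨a, cs⟩
    simp [card]
  | succ n ih =>
    have := ih.to_subtype
    refine (Set.countable_range fun p : ℤ × List {t : LTree | t.card ≤ n} =>
      node p.1 (p.2.map Subtype.val)).mono ?_
    rintro ⟨a, cs⟩ h
    have hcs : ∀ c ∈ cs, c ∈ {t : LTree | t.card ≤ n} := fun c hc =>
      Nat.lt_succ_iff.1 ((card_lt_card_node hc).trans_le h)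
    exact ⟨(a, cs.attach.map fun c => ⟨c.1, hcs c.1 c.2⟩), by simp [List.map_map, Function.comp_def]⟩

instance : Countable LTree := by
  rw [← Set.countable_univ_iff]
  convert Set.countable_iUnion countable_card_le
  ext t
  simpa using ⟨t.card, le_rfl⟩

instance : DiscreteMeasurableSpace LTree := ⟨fun _ => trivial⟩

section Mass

variable (ξ : PMF ℕ) (η : (k : ℕ) → PMF (Fin k → ℤ))

-- The constant coefficient of `seriesSum_list_fiber`, with no variables.
open Classical in
theorem tsum_list_fiber {ι κ : Type*} (h : ι → κ) (f : ι → ℝ≥0∞) (ls : List κ) :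
    (∑' cs : List ι, if cs.map h = ls then (cs.map f).prod else 0) =
      (ls.map fun b => ∑' i, if h i = b then f i else 0).prod := by
  have := congrArg (constantCoeff (σ := Empty) (R := ℝ≥0∞))
    (seriesSum_list_fiber h (fun i => C (f i)) ls)
  rw [map_list_prod, List.map_map] at this
  simp only [← coeff_zero_eq_constantCoeff_apply, coeff_seriesSum] at this
  refine Eq.trans (tsum_congr fun cs => ?_) (this.trans (congrArg List.prod
    (List.map_congr_left fun b _ => ?_)))
  · split_ifs
    · rw [coeff_zero_eq_constantCoeff_apply, map_list_prod, List.map_map]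
      simp [Function.comp_def]
    · simp
  · simp only [Function.comp_apply, ← coeff_zero_eq_constantCoeff_apply, coeff_seriesSum]
    refine tsum_congr fun i => ?_
    split_ifs <;> simp

theorem tsum_childFactor (a : ℤ) : ∑' ls, childFactor ξ η a ls = 1 := by
  rw [← List.equivSigmaTuple.symm.tsum_eq, ENNReal.tsum_sigma']
  have h : ∀ k : ℕ, ∑' e : Fin k → ℤ, childFactor ξ η a (List.equivSigmaTuple.symm ⟨k, e⟩) = ξ k := by
    intro k
    have h1 : ∀ e : Fin k → ℤ, childFactor ξ η a (List.equivSigmaTuple.symm ⟨k, e⟩) =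
        ξ k * η k (Equiv.subRight (fun _ => a) e) := fun e => childFactor_ofFn ξ η a e
    simp only [h1]
    rw [ENNReal.tsum_mul_left, (Equiv.subRight fun _ : Fin k => a).tsum_eq (η k), (η k).tsum_coe,
      mul_one]
  simp only [h, ξ.tsum_coe]

-- By the branching property, the mass up to `n + 1` vertices is at most a sum over the children's
-- labels of `childFactor` times masses up to `n` vertices, each at most 1; and `childFactor` sums
-- to 1.
open Classical in
theorem tsum_weight_card_le (n : ℕ) (x : ℤ) :
    ∑' t : LTree, (if t.rootLabel = x ∧ t.card ≤ n then t.weight ξ η else 0) ≤ 1 := by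
  induction n generalizing x with
  | zero =>
    have : ∀ t : LTree, ¬ t.card ≤ 0 := by
      rintro ⟨a, cs⟩
      simp [card]
    simp [this]
  | succ n ih =>
    let f : LTree → ℝ≥0∞ := fun c => if c.card ≤ n then c.weight ξ η else 0
    have h1 : ∀ cs, (if (node x cs).card ≤ n + 1 then (node x cs).weight ξ η else 0) ≤
        childFactor ξ η x (cs.map rootLabel) * (cs.map f).prod := by
      intro cs
      split_ifs with h
      · rw [weight_node]
        refine le_of_eq ?_
        congr 2
        refine List.map_congr_left fun c hc => ?_
        rw [show f c = _ from if_pos (Nat.lt_succ_iff.1 ((card_lt_card_node hc).trans_le h))]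
      · exact zero_le
    calc ∑' t : LTree, (if t.rootLabel = x ∧ t.card ≤ n + 1 then t.weight ξ η else 0)
        = ∑' a : ℤ, ∑' cs, if (node a cs).rootLabel = x ∧ (node a cs).card ≤ n + 1 then
            (node a cs).weight ξ η else 0 := by
          rw [← equivProd.symm.tsum_eq, ENNReal.tsum_prod']
          rfl
      _ = ∑' cs, if (node x cs).card ≤ n + 1 then (node x cs).weight ξ η else 0 := by
          rw [tsum_eq_single x]
          · simp [rootLabel]
          · intro a ha
            simp [rootLabel, ha]
      _ ≤ ∑' cs : List LTree, childFactor ξ η x (cs.map rootLabel) * (cs.map f).prod :=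
          ENNReal.tsum_le_tsum h1
      _ = ∑' ls, ∑' cs : List LTree, if cs.map rootLabel = ls then
            childFactor ξ η x ls * (cs.map f).prod else 0 := by
          rw [ENNReal.tsum_comm]
          congr 1
          funext cs
          simp
      _ = ∑' ls, childFactor ξ η x ls * (ls.map fun b => ∑' c : LTree,
            if c.rootLabel = b then f c else 0).prod := by
          congr 1
          funext ls
          simp only [← mul_ite_zero, ENNReal.tsum_mul_left]
          congr 1
          convert tsum_list_fiber rootLabel f ls
      _ ≤ ∑' ls, childFactor ξ η x ls := by
          have hf : ∀ b : ℤ, (∑' c : LTree, if c.rootLabel = b then f c else 0) ≤ 1 := by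
            intro b
            refine le_trans (le_of_eq (tsum_congr fun c => ?_)) (ih b)
            rw [ite_and]
          refine ENNReal.tsum_le_tsum fun ls => mul_le_of_le_one_right' ?_
          induction ls with
          | nil => simp
          | cons b ls ihl =>
            rw [List.map_cons, List.prod_cons]
            exact mul_le_one' (hf b) ihl
      _ = 1 := tsum_childFactor ξ η x

open Classical in
theorem tsum_weight_le_one (x : ℤ) :
    ∑' t : LTree, (if t.rootLabel = x then t.weight ξ η else 0) ≤ 1 := by
  rw [ENNReal.tsum_eq_iSup_sum]
  refine iSup_le fun s => le_trans ?_ (tsum_weight_card_le ξ η (s.sup card) x)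
  refine le_trans (Finset.sum_le_sum fun t ht => ?_) (ENNReal.sum_le_tsum s)
  rw [ite_and, if_pos (Finset.le_sup ht)]

open Classical in
theorem treeLaw_apply (x : ℤ) (A : Set LTree) :
    treeLaw ξ η x A = ∑' t : LTree, if t.rootLabel = x then (if t ∈ A then t.weight ξ η else 0)
      else 0 := by
  rw [treeLaw, Measure.restrict_apply .of_discrete, Measure.sum_apply _ .of_discrete]
  congr 1
  funext t
  rw [Measure.smul_apply, Measure.dirac_apply' _ .of_discrete]
  by_cases h1 : t.rootLabel = x <;> by_cases h2 : t ∈ A <;> simp [h1, h2]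

instance (x : ℤ) : IsFiniteMeasure (treeLaw ξ η x) := by
  classical
  refine ⟨lt_of_le_of_lt ?_ ENNReal.one_lt_top⟩
  rw [treeLaw_apply]
  simpa using tsum_weight_le_one ξ η x

instance : IsFiniteMeasure (posExcursionLaw ξ η) := by
  unfold posExcursionLaw
  infer_instance

end Mass

/-- The multiplicities of the edges, by type. -/
noncomputable def edgeCount (t : LTree) : ℤ × ℤ →₀ ℕ :=
  (t.edges.map fun e => Finsupp.single e 1).sum

theorem edgeMonomial_eq (t : LTree) : t.edgeMonomial = monomial t.edgeCount 1 := by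
  rw [edgeMonomial, edgeCount]
  induction t.edges with
  | nil => simp
  | cons e es ih =>
    rw [List.map_cons, List.prod_cons, ih, List.map_cons, List.sum_cons, X, monomial_mul_monomial,
      one_mul]

section Weights

variable (ξ : PMF ℕ) (η : (k : ℕ) → PMF (Fin k → ℤ))

theorem edgeSeries_eq (t : LTree) : t.edgeSeries ξ η = monomial t.edgeCount (t.weight ξ η) := by
  rw [edgeSeries, edgeMonomial_eq, ← monomial_zero_eq_C_apply, monomial_mul_monomial, zero_add,
    mul_one]

theorem truncSeries_eq (l : ℤ) (t : LTree) :
    t.truncSeries ξ η l = monomial t.edgeCount (t.truncWeight ξ η l) := by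
  rw [truncSeries, edgeMonomial_eq, ← monomial_zero_eq_C_apply, monomial_mul_monomial, zero_add,
    mul_one]

open Classical in
theorem coeffPairing_rootSeries (g : (ℤ × ℤ →₀ ℕ) → ℝ≥0∞) (x : ℤ) :
    coeffPairing g (rootSeries ξ η x) =
      ∑' t : LTree, if t.rootLabel = x then t.weight ξ η * g t.edgeCount else 0 := by
  rw [rootSeries, coeffPairing_seriesSum]
  congr 1
  funext t
  split_ifs
  · rw [edgeSeries_eq, coeffPairing_monomial]
  · exact coeffPairing_zero g

theorem coeffPairing_one_rootSeries (x : ℤ) :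
    coeffPairing (fun _ => 1) (rootSeries ξ η x) = treeLaw ξ η x Set.univ := by
  classical
  rw [coeffPairing_rootSeries, treeLaw_apply]
  simp

-- All edge variables are set to 1 in `seriesSum_trunc_fiber`. Each zero of `τ` is a leaf where a
-- whole tree was cut off, which accounts for one factor of the total mass of `Π_0`.
open Classical in
theorem posExcursionLaw_singleton (τ : LTree) :
    posExcursionLaw ξ η {τ} = if τ.rootLabel = 1 then
      τ.truncWeight ξ η 0 * treeLaw ξ η 0 Set.univ ^ τ.zeros else 0 := by
  have h1 : coeffPairing (fun _ => 1) (seriesSum fun t : LTree =>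
      if t.trunc 0 = τ then t.edgeSeries ξ η else 0) =
      τ.truncWeight ξ η 0 * treeLaw ξ η 0 Set.univ ^ τ.zeros := by
    rw [seriesSum_trunc_fiber, coeffPairing_one_mul, coeffPairing_one_pow,
      coeffPairing_one_rootSeries, truncSeries_eq, coeffPairing_monomial, mul_one]
    rfl
  rw [← h1, coeffPairing_seriesSum, posExcursionLaw, Measure.map_apply .of_discrete .of_discrete,
    treeLaw_apply]
  split_ifs with h
  · congr 1
    funext t
    simp only [Set.mem_preimage, Set.mem_singleton_iff]
    by_cases ht : t.trunc 0 = τ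
    · rw [if_pos ht, if_pos ht, if_pos (by rw [← rootLabel_trunc 0 t, ht, h]), edgeSeries_eq,
        coeffPairing_monomial, mul_one]
    · simp [ht, coeffPairing_zero]
  · refine ENNReal.tsum_eq_zero.2 fun t => ?_
    split_ifs with h2 h3
    · exact absurd (by rw [← h3, rootLabel_trunc, h2]) h
    · rfl
    · rfl

end Weights

end LTree

/-! ### Edge multiplicities and shifts of the labels -/

namespace LTree

open MvPowerSeries

/-- The number of edges, counted with multiplicity, whose type satisfies `A`. -/
noncomputable def typeCount (A : ℤ × ℤ → Prop) (N : ℤ × ℤ →₀ ℕ) : ℕ :=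
  open Classical in N.sum fun e n => if A e then n else 0

theorem typeCount_add (A : ℤ × ℤ → Prop) (N₁ N₂ : ℤ × ℤ →₀ ℕ) :
    typeCount A (N₁ + N₂) = typeCount A N₁ + typeCount A N₂ := by
  classical
  refine Finsupp.sum_add_index' (fun e => by simp) fun e a b => ?_
  split_ifs <;> simp

theorem typeCount_sum {ι : Type*} (A : ℤ × ℤ → Prop) (I : Finset ι) (N : ι → ℤ × ℤ →₀ ℕ) :
    typeCount A (∑ i ∈ I, N i) = ∑ i ∈ I, typeCount A (N i) :=
  map_sum (⟨⟨typeCount A, Finsupp.sum_zero_index⟩, typeCount_add A⟩ : (ℤ × ℤ →₀ ℕ) →+ ℕ) N I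

open Classical in
theorem typeCount_single (A : ℤ × ℤ → Prop) (e : ℤ × ℤ) (n : ℕ) :
    typeCount A (Finsupp.single e n) = if A e then n else 0 :=
  Finsupp.sum_single_index (by simp)

theorem typeCount_congr {A B : ℤ × ℤ → Prop} {N : ℤ × ℤ →₀ ℕ}
    (h : ∀ e, N e ≠ 0 → (A e ↔ B e)) : typeCount A N = typeCount B N := by
  classical
  refine Finsupp.sum_congr fun e he => ?_
  simp only [h e (Finsupp.mem_support_iff.1 he)]

theorem typeCount_false (N : ℤ × ℤ →₀ ℕ) : typeCount (fun _ => False) N = 0 := by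
  simp [typeCount]

theorem edgeCount_apply (t : LTree) (e : ℤ × ℤ) : t.edgeCount e = t.edges.count e := by
  rw [edgeCount]
  induction t.edges with
  | nil => simp
  | cons e' es ih => simp [ih, List.count_cons, Finsupp.single_apply, add_comm]

theorem typeCount_edgeCount (A : ℤ × ℤ → Prop) [DecidablePred A] (t : LTree) :
    typeCount A t.edgeCount = t.edges.countP A := by
  rw [edgeCount]
  induction t.edges with
  | nil => simp [typeCount]
  | cons e' es ih =>
    simp only [List.map_cons, List.sum_cons, typeCount_add, typeCount_single, ih, List.countP_cons,
      decide_eq_true_eq]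
    rw [add_comm]
    congr

/-- The profile at level `j`, as a function of the edge multiplicities. -/
noncomputable def countProfile (j : ℤ) (N : ℤ × ℤ →₀ ℕ) : ℕ × ℕ × ℕ :=
  (N (j - 1, j), N (j, j - 1), typeCount (fun e => e.1 ≤ j - 1 ∧ e.2 ≤ j - 1) N)

theorem size_eq (t : LTree) : t.size = typeCount (fun _ => True) t.edgeCount := by
  simp [typeCount_edgeCount, size]

section Shift

/-- Add `b` to all labels. -/
def shift (b : ℤ) : LTree → LTree
  | node a cs => node (a + b) (cs.map fun c => c.shift b)

theorem shift_node (a b : ℤ) (cs : List LTree) :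
    (node a cs).shift b = node (a + b) (cs.map fun c => c.shift b) := by
  rw [shift]

theorem shift_shift_neg (b : ℤ) (t : LTree) : (t.shift b).shift (-b) = t := by
  induction t using induct with
  | h a cs ih =>
    rw [shift_node, shift_node, List.map_map, add_neg_cancel_right]
    congr 1
    conv_rhs => rw [← List.map_id cs]
    exact List.map_congr_left ih

/-- Shifting the labels is a bijection on labelled trees. -/
def shiftEquiv (b : ℤ) : LTree ≃ LTree where
  toFun := shift b
  invFun := shift (-b)
  left_inv := shift_shift_neg b
  right_inv t := by simpa using shift_shift_neg (-b) t

theorem rootLabel_shift (b : ℤ) (t : LTree) : (t.shift b).rootLabel = t.rootLabel + b := by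
  cases t
  rw [shift_node]
  rfl

theorem edges_shift (b : ℤ) (t : LTree) :
    (t.shift b).edges = t.edges.map fun e => (e.1 + b, e.2 + b) := by
  induction t using induct with
  | h a cs ih =>
    rw [shift_node, edges, edges, List.map_flatMap, List.flatMap_map]
    refine List.flatMap_congr fun c hc => ?_
    rw [ih c hc, rootLabel_shift, List.map_cons]

theorem weight_shift (ξ : PMF ℕ) (η : (k : ℕ) → PMF (Fin k → ℤ)) (b : ℤ) (t : LTree) :
    (t.shift b).weight ξ η = t.weight ξ η := by
  induction t using induct with
  | h a cs ih =>
    rw [shift_node, weight_node, weight_node, List.map_map, List.map_map,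
      ← childFactor_map_add ξ η a b (cs.map rootLabel), List.map_map]
    congr 2
    · refine List.map_congr_left fun c _ => rootLabel_shift b c
    · exact List.map_congr_left ih

theorem profile_shift (b : ℤ) (m : ℕ) (t : LTree) :
    (t.shift b).profile m = countProfile (m - b) t.edgeCount := by
  have hc : ∀ x y : ℤ, (t.shift b).edges.count (x, y) = t.edges.count (x - b, y - b) := by
    intro x y
    rw [edges_shift, List.count, List.countP_map, List.count]
    refine List.countP_congr fun e _ => ?_
    simp only [Function.comp_apply, beq_iff_eq, Prod.ext_iff]
    omega
  simp only [profile, up, down, massBelow, countProfile, edgeCount_apply, typeCount_edgeCount, hc]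
  rw [show (m : ℤ) - b - 1 = m - 1 - b by ring]
  refine Prod.ext rfl (Prod.ext rfl ?_)
  rw [edges_shift, List.countP_map]
  refine List.countP_congr fun e _ => ?_
  simp only [Function.comp_apply, decide_eq_true_eq]
  omega

theorem size_shift (b : ℤ) (t : LTree) : (t.shift b).size = t.size := by
  simp [size, edges_shift]

end Shift

/-! ### Excursions and profiles in terms of edge multiplicities -/

section Law

variable {ξ : PMF ℕ} {η : (k : ℕ) → PMF (Fin k → ℤ)}
  (hη : ∀ (k : ℕ) (e : Fin k → ℤ), η k e ≠ 0 → ∀ i, e i = -1 ∨ e i = 0 ∨ e i = 1)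

theorem step_above (a b : ℤ) (ha : 1 ≤ a) (h : b - a = -1 ∨ b - a = 0 ∨ b - a = 1) :
    1 ≤ b ∨ (a = 1 ∧ b = 0) := by
  omega

theorem step_below (a b : ℤ) (ha : a ≤ 0) (h : b - a = -1 ∨ b - a = 0 ∨ b - a = 1) :
    b ≤ 0 ∨ (a = 0 ∧ b = 1) := by
  omega

theorem prod_monomial {ι : Type*} (I : Finset ι) (N : ι → ℤ × ℤ →₀ ℕ) (a : ι → ℝ≥0∞) :
    ∏ i ∈ I, (monomial (N i) (a i) : MvPowerSeries (ℤ × ℤ) ℝ≥0∞) =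
      monomial (∑ i ∈ I, N i) (∏ i ∈ I, a i) := by
  classical
  induction I using Finset.induction_on with
  | empty => simp
  | insert i I hi ih =>
    rw [Finset.prod_insert hi, Finset.prod_insert hi, Finset.sum_insert hi, ih,
      monomial_mul_monomial]

include hη in
open Classical in
/-- The joint law of the number of zeros and of the edge multiplicities of `p` independent positive
excursions. -/
theorem pi_posExcursionLaw_apply (p q : ℕ) (G : (ℤ × ℤ →₀ ℕ) → Prop) :
    (Measure.pi fun _ : Fin p => posExcursionLaw ξ η)
        {τ | ∑ k, (τ k).zeros = q ∧ G (∑ k, (τ k).edgeCount)} =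
      treeLaw ξ η 0 Set.univ ^ q * coeffPairing (fun N => if G N then 1 else 0)
        (X (1, 0) ^ q * PowerSeries.coeff q (truncGenSeries ξ η 1 0 1 ^ p)) := by
  rw [coeff_pow_eq_seriesSum (z := fun t : LTree => t.labels.count 0) (coeff_truncGenSeries ξ η 1 0 1),
    mul_seriesSum, coeffPairing_seriesSum, ← ENNReal.tsum_mul_left,
    ← Measure.tsum_indicator_apply_singleton _ _ .of_discrete]
  refine tsum_congr fun τ => ?_
  rw [Set.indicator_apply, Measure.pi_singleton]
  simp only [Set.mem_ofPred_eq]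
  by_cases hq : ∑ k, (τ k).zeros = q
  swap
  · rw [if_neg (fun h => hq h.1), if_neg (show ¬ ∑ k, (τ k).labels.count 0 = q from hq), mul_zero,
      coeffPairing_zero, mul_zero]
  rw [if_pos (show ∑ k, (τ k).labels.count 0 = q from hq)]
  -- The `q` zeros of the excursions correspond to their `q` edges `(1, 0)`, so `X (1, 0) ^ q`
  -- completes the core monomials to full ones.
  have h1 : (X (1, 0) ^ q * ∏ k, (if (τ k).rootLabel = 1 then (τ k).coreSeries ξ η 1 0 else 0) :
      MvPowerSeries (ℤ × ℤ) ℝ≥0∞) = monomial (∑ k, (τ k).edgeCount)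
        (∏ k, if (τ k).rootLabel = 1 then (τ k).truncWeight ξ η 0 else 0) := by
    rw [← hq, ← Finset.prod_pow_eq_pow_sum, ← Finset.prod_mul_distrib, ← prod_monomial]
    refine Finset.prod_congr rfl fun k _ => ?_
    split_ifs with h
    · rw [← truncSeries_eq, truncSeries_eq_coreSeries_mul_pow hη step_above (by norm_num) _
        (by rw [h]), mul_comm]
      rfl
    · simp
  have h2 : ∏ k, posExcursionLaw ξ η {τ k} = treeLaw ξ η 0 Set.univ ^ q *
      ∏ k, if (τ k).rootLabel = 1 then (τ k).truncWeight ξ η 0 else 0 := by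
    rw [← hq, ← Finset.prod_pow_eq_pow_sum, ← Finset.prod_mul_distrib]
    refine Finset.prod_congr rfl fun k _ => ?_
    rw [posExcursionLaw_singleton]
    split_ifs
    · rw [mul_comm]
    · simp
  rw [h1, coeffPairing_monomial, h2]
  by_cases hG : G (∑ k, (τ k).edgeCount)
  · simp [hq, hG]
  · simp [hG]

/-- The value at the next level of the profile, in terms of the excursions above the level. -/
def nextProfile (x : ℕ × ℕ × ℕ) (τ : Fin x.1 → LTree) : ℕ × ℕ × ℕ :=
  (∑ k, (τ k).up 2, ∑ k, (τ k).down 2, x.2.2 + x.1 + ∑ k, (τ k).massBelow 2)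

/-- The total size of a tree, in terms of the excursions above a level. -/
def totalSize (x : ℕ × ℕ × ℕ) (τ : Fin x.1 → LTree) : ℕ :=
  x.2.2 + x.1 + ∑ k, (τ k).size

/-- The value at the next level of the profile, in terms of the edges above the level. -/
noncomputable def nextCount (x : ℕ × ℕ × ℕ) (N : ℤ × ℤ →₀ ℕ) : ℕ × ℕ × ℕ :=
  (N (1, 2), N (2, 1), x.2.2 + x.1 + typeCount (fun e => e.1 ≤ 1 ∧ e.2 ≤ 1) N)

theorem nextProfile_eq (x : ℕ × ℕ × ℕ) (τ : Fin x.1 → LTree) :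
    nextProfile x τ = nextCount x (∑ k, (τ k).edgeCount) := by
  simp only [nextProfile, nextCount, typeCount_sum, typeCount_edgeCount, Finsupp.finsetSum_apply,
    edgeCount_apply, up, down, massBelow]
  norm_num

theorem totalSize_eq (x : ℕ × ℕ × ℕ) (τ : Fin x.1 → LTree) :
    totalSize x τ = x.2.2 + x.1 + typeCount (fun _ => True) (∑ k, (τ k).edgeCount) := by
  simp only [totalSize, typeCount_sum, size_eq]

/-- Edge types on or above the cut level. -/
def Above (e : ℤ × ℤ) : Prop := 1 ≤ e.1

/-- Edge types below the cut level, including the edge type crossing it upwards. -/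
def Below (e : ℤ × ℤ) : Prop := (e.1 ≤ 0 ∧ e.2 ≤ 0) ∨ e = (0, 1)

/-- Edges above the cut start at a label at least 1, so among them only the downward crossings `(1,
0)` can be seen at levels up to 1. -/
theorem countProfile_add_of_le_one {N₁ N₂ : ℤ × ℤ →₀ ℕ} (h₁ : ∀ e, N₁ e ≠ 0 → Above e)
    {j : ℤ} (hj : j ≤ 1) :
    countProfile j (N₁ + N₂) = countProfile j (Finsupp.single (1, 0) (N₁ (1, 0)) + N₂) := by
  have h0 : ∀ e : ℤ × ℤ, e.1 ≤ 0 → N₁ e = 0 := by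
    intro e he
    by_contra h
    have : 1 ≤ e.1 := h₁ e h
    omega
  have hm : typeCount (fun e => e.1 ≤ j - 1 ∧ e.2 ≤ j - 1) N₁ = 0 := by
    rw [← typeCount_false N₁]
    refine typeCount_congr fun e he => ?_
    have : 1 ≤ e.1 := h₁ e he
    simp only [iff_false]
    omega
  simp only [countProfile, typeCount_add, hm, Finsupp.add_apply, typeCount_single,
    Finsupp.single_apply, Prod.mk.injEq]
  refine ⟨?_, ?_, ?_⟩
  · rw [h0 _ (by simpa using hj), if_neg (by omega)]
  · by_cases h : j = 1
    · subst h
      simp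
    · rw [h0 _ (by simp; omega), if_neg (by omega)]
  · rw [if_neg (by omega)]

theorem typeCount_below {N : ℤ × ℤ →₀ ℕ} (h : ∀ e, N e ≠ 0 → Below e) {A : ℤ × ℤ → Prop}
    (hA : ∀ e, Below e → A e) :
    typeCount A N = typeCount (fun e => e.1 ≤ 0 ∧ e.2 ≤ 0) N + N (0, 1) := by
  classical
  have h1 : N (0, 1) = typeCount (fun e => e = (0, 1)) N := by
    rw [typeCount, Finsupp.sum, Finset.sum_eq_single (0, 1)]
    · simp
    · intro e _ he
      rw [if_neg he]
    · simp
  rw [h1, typeCount, typeCount, typeCount, ← Finsupp.sum_add]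
  refine Finsupp.sum_congr fun e he => ?_
  have hB := h e (Finsupp.mem_support_iff.1 he)
  rw [if_pos (hA e hB)]
  rcases hB with hB | hB
  · rw [if_pos hB, if_neg (by rintro rfl; omega), add_zero]
  · subst hB
    simp

/-- The edges between labels at most 1 are the `v` edges strictly below the cut, the `p` upward
crossings, and edges of the excursions; the downward crossings belong to the last group, so `q` is
not added separately. -/
theorem countProfile_two_add {N₁ N₂ : ℤ × ℤ →₀ ℕ} {p q v : ℕ} (h₂ : ∀ e, N₂ e ≠ 0 → Below e)
    (hp : N₂ (0, 1) = p) (hv : typeCount (fun e => e.1 ≤ 0 ∧ e.2 ≤ 0) N₂ = v) :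
    countProfile 2 (N₁ + N₂) = nextCount (p, q, v) N₁ := by
  have h0 : ∀ e : ℤ × ℤ, 1 ≤ e.1 → N₂ e = 0 := by
    intro e he
    by_contra h
    rcases h₂ e h with h | rfl
    · omega
    · simp at he
  have hm : typeCount (fun e => e.1 ≤ 1 ∧ e.2 ≤ 1) N₂ = v + p := by
    rw [typeCount_below h₂, hp, hv]
    rintro e (h | rfl)
    · omega
    · simp
  simp only [countProfile, nextCount, Finsupp.add_apply, typeCount_add]
  norm_num
  rw [hm, h0 (1, 2) (by simp), h0 (2, 1) (by simp), add_comm]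
  simp

end Law

end LTree

/-! ### Factorization at a level and the transition kernel -/

namespace LTree

open MvPowerSeries

variable {ξ : PMF ℕ} {η : (k : ℕ) → PMF (Fin k → ℤ)}

section

variable (hη : ∀ (k : ℕ) (e : Fin k → ℤ), η k e ≠ 0 → ∀ i, e i = -1 ∨ e i = 0 ∨ e i = 1)

include hη in
open Classical in
/-- The bidegree `(p, q)` part, in the crossing edges, of the generating series of trees started
below the cut level factorizes into the contributions above and below the level. -/
theorem exists_bidegPart_rootSeries_eq {x : ℤ} (hx : x ≤ 0) (p q : ℕ) :
    ∃ L : MvPowerSeries (ℤ × ℤ) ℝ≥0∞, SupportedOn (fun e => e.1 ≤ 0 ∧ e.2 ≤ 0) L ∧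
      bidegPart (0, 1) (1, 0) p q (rootSeries ξ η x) =
        X (1, 0) ^ q * PowerSeries.coeff q (truncGenSeries ξ η 1 0 1 ^ p) *
          (X (0, 1) ^ p * L) := by
  have hE := supportedOn_coeff_truncGenSeries (ξ := ξ) (x := 1) hη step_above (by norm_num) le_rfl
  have hF := supportedOn_coeff_truncGenSeries (ξ := ξ) (x := 0) hη step_below (by norm_num) le_rfl
  have hG := supportedOn_coeff_truncGenSeries (ξ := ξ) (x := x) hη step_below (by norm_num) hx
  have hfree : ∀ e : ℤ × ℤ, e.1 ≤ 0 ∧ e.2 ≤ 0 → e ≠ (0, 1) ∧ e ≠ (1, 0) := by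
    rintro e he
    constructor <;> rintro rfl <;> simp at he
  have hfree' : ∀ e : ℤ × ℤ, 1 ≤ e.1 ∧ 1 ≤ e.2 → e ≠ (0, 1) ∧ e ≠ (1, 0) := by
    rintro e he
    constructor <;> rintro rfl <;> simp at he
  obtain ⟨L, hL, h⟩ := exists_bidegPart_sumEval_eq (y := ((0, 1) : ℤ × ℤ)) (r := (1, 0)) (by simp)
    (fun n => (hE n).mono hfree') (fun n => (hF n).mono hfree)
    (U := X (0, 1) * rootSeries ξ η 1) (D := X (1, 0) * rootSeries ξ η 0)
    (by rw [← rootSeries_eq_sumEval hη step_above (by norm_num) le_rfl])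
    (by rw [← rootSeries_eq_sumEval hη step_below (by norm_num) le_rfl])
    (fun n => (hG n).mono hfree) hF hG p q
  refine ⟨L, hL, ?_⟩
  rw [rootSeries_eq_sumEval hη step_below (by norm_num) hx, h]
  ring

include hη in
/-- Given the profile up to level `m`, the excursions above the level are independent positive
excursions conditioned on their total number of zeros. -/
theorem exists_treeLaw_eq_mul (hZ : treeLaw ξ η 0 Set.univ ≠ 0) {m : ℕ} (hm : 1 ≤ m)
    (J : ℕ → Prop) (hJ : ∀ k, J k → k ≤ m) (hJm : J m) (s : ℕ → ℕ × ℕ × ℕ) :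
    ∃ L : ℝ≥0∞, ∀ F : ℕ × ℕ × ℕ → ℕ → Prop,
      treeLaw ξ η 0 {t | (∀ k, J k → t.profile k = s k) ∧ F (t.profile (m + 1)) t.size} =
        (Measure.pi fun _ : Fin (s m).1 => posExcursionLaw ξ η)
          {τ | ∑ k, (τ k).zeros = (s m).2.1 ∧ F (nextProfile (s m) τ) (totalSize (s m) τ)} * L := by
  classical
  obtain ⟨p, q, v, hs⟩ : ∃ p q v, s m = (p, q, v) := ⟨_, _, _, rfl⟩
  rw [hs]
  obtain ⟨L, hL, hW⟩ := exists_bidegPart_rootSeries_eq (ξ := ξ) hη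
    (show (1 - m : ℤ) ≤ 0 by omega) p q
  let past : (ℤ × ℤ →₀ ℕ) → Prop := fun N => ∀ k : ℕ, J k → countProfile (k - (m - 1)) N = s k
  -- The past depends on the upper part only through its `q` downward crossings, which are put back
  -- by hand next to the lower part.
  let g₂ : (ℤ × ℤ →₀ ℕ) → ℝ≥0∞ := fun N => if past (Finsupp.single (1, 0) q + N) then 1 else 0
  -- The inverse power removes the mass of the trees cut off at the `q` zeros, which the law of the
  -- excursions includes. The constant is chosen before `F`, so a trivial `F` later identifies it.
  refine ⟨(treeLaw ξ η 0 Set.univ ^ q)⁻¹ * coeffPairing g₂ (X (0, 1) ^ p * L), fun F => ?_⟩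
  let g : (ℤ × ℤ →₀ ℕ) → ℝ≥0∞ := fun N =>
    if past N ∧ F (countProfile 2 N) (typeCount (fun _ => True) N) then 1 else 0
  let G : (ℤ × ℤ →₀ ℕ) → Prop := fun N =>
    F (nextCount (p, q, v) N) (v + p + typeCount (fun _ => True) N)
  -- A tree rooted at 0 is the shift by `m - 1` of a tree rooted at `1 - m ≤ 0`. Level `m` becomes
  -- level 1, so the cut always lies between 0 and 1.
  have h1 : treeLaw ξ η 0 {t | (∀ k, J k → t.profile k = s k) ∧ F (t.profile (m + 1)) t.size} =
      coeffPairing g (rootSeries ξ η (1 - m)) := by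
    rw [treeLaw_apply, coeffPairing_rootSeries, ← (shiftEquiv (m - 1)).tsum_eq]
    refine tsum_congr fun t => ?_
    have hr : (shiftEquiv ((m : ℤ) - 1) t).rootLabel = 0 ↔ t.rootLabel = 1 - m := by
      change (t.shift (m - 1)).rootLabel = 0 ↔ _
      rw [rootLabel_shift]
      omega
    have hw : (shiftEquiv ((m : ℤ) - 1) t).weight ξ η = t.weight ξ η := weight_shift ξ η _ t
    have hmem : shiftEquiv ((m : ℤ) - 1) t ∈
        {t : LTree | (∀ k, J k → t.profile k = s k) ∧ F (t.profile (m + 1)) t.size} ↔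
        past t.edgeCount ∧ F (countProfile 2 t.edgeCount)
          (typeCount (fun _ => True) t.edgeCount) := by
      change (∀ k, J k → (t.shift (m - 1)).profile k = s k) ∧
        F ((t.shift (m - 1)).profile (m + 1)) (t.shift (m - 1)).size ↔ _
      simp only [profile_shift, size_shift, past]
      rw [size_eq, show ((m + 1 : ℕ) : ℤ) - (m - 1) = 2 by push_cast; ring]
    by_cases ha : t.rootLabel = 1 - m
    · rw [if_pos (hr.2 ha), if_pos ha, hw]
      by_cases hb : past t.edgeCount ∧ F (countProfile 2 t.edgeCount)
          (typeCount (fun _ => True) t.edgeCount)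
      · rw [if_pos (hmem.2 hb), show g t.edgeCount = 1 from if_pos hb, mul_one]
      · rw [if_neg fun h => hb (hmem.1 h), show g t.edgeCount = 0 from if_neg hb, mul_zero]
    · rw [if_neg fun h => ha (hr.1 h), if_neg ha]
  have hpast : ∀ N, past N → N (0, 1) = p ∧ N (1, 0) = q ∧
      typeCount (fun e => e.1 ≤ 0 ∧ e.2 ≤ 0) N = v := by
    intro N hN
    have := hN m hJm
    rw [hs, show (m : ℤ) - (m - 1) = 1 by ring, countProfile] at this
    simpa using this
  -- Since `J m` holds, the past fixes the numbers of crossings, so only bidegree `(p, q)`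
  -- contributes.
  have h2 : coeffPairing g (rootSeries ξ η (1 - m)) =
      coeffPairing g (bidegPart (0, 1) (1, 0) p q (rootSeries ξ η (1 - m))) := by
    refine tsum_congr fun N => ?_
    rw [coeff_bidegPart]
    by_cases hN : past N
    · rw [if_pos ⟨(hpast N hN).1, (hpast N hN).2.1⟩]
    · rw [show g N = 0 from if_neg fun h => hN h.1, mul_zero, mul_zero]
  have hE := supportedOn_coeff_truncGenSeries (ξ := ξ) (x := 1) hη step_above (by norm_num) le_rfl
  have h3 : coeffPairing g (bidegPart (0, 1) (1, 0) p q (rootSeries ξ η (1 - m))) =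
      coeffPairing (fun N => if G N then 1 else 0)
        (X (1, 0) ^ q * PowerSeries.coeff q (truncGenSeries ξ η 1 0 1 ^ p)) *
      coeffPairing g₂ (X (0, 1) ^ p * L) := by
    rw [hW]
    refine coeffPairing_mul fun N₁ N₂ hN₁ hN₂ => ?_
    have hA : ∀ e, N₁ e ≠ 0 → Above e := by
      refine ((SupportedOn.X (A := Above) ?_).pow q).mul
        (SupportedOn.coeff_powerSeries_pow (fun n => (hE n).mono ?_) p q) N₁ hN₁
      · exact le_rfl
      · exact fun e he => he.1
    have hB : ∀ e, N₂ e ≠ 0 → Below e :=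
      ((SupportedOn.X (A := Below) (Or.inr rfl)).pow p).mul (hL.mono fun e he => Or.inl he) N₂ hN₂
    have hq : N₁ (1, 0) = q := by
      have := bideg_of_coeff_ne_zero (y := ((0, 1) : ℤ × ℤ)) (r := (1, 0)) (by simp)
        (SupportedOn.coeff_powerSeries_pow (fun n => (hE n).mono fun e he => ?_) p q) 0 q N₁
        (by rwa [pow_zero, one_mul])
      · exact this.2
      · constructor <;> rintro rfl <;> simp at he
    have hp : N₂ (0, 1) = p := by
      have := bideg_of_coeff_ne_zero (y := ((0, 1) : ℤ × ℤ)) (r := (1, 0)) (by simp)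
        (hL.mono fun e he => ?_) p 0 N₂ (by rwa [pow_zero, mul_one])
      · exact this.1
      · constructor <;> rintro rfl <;> simp at he
    have hiff : past (N₁ + N₂) ↔ past (Finsupp.single (1, 0) q + N₂) := by
      refine forall_congr' fun k => imp_congr_right fun hk => ?_
      rw [countProfile_add_of_le_one hA (by have := hJ k hk; omega), hq]
    by_cases hN : past (Finsupp.single (1, 0) q + N₂)
    · have hv : typeCount (fun e => e.1 ≤ 0 ∧ e.2 ≤ 0) N₂ = v := by
        have := (hpast _ hN).2.2
        rwa [typeCount_add, typeCount_single, if_neg (by simp), zero_add] at this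
      have hG : F (countProfile 2 (N₁ + N₂)) (typeCount (fun _ => True) (N₁ + N₂)) ↔ G N₁ := by
        rw [countProfile_two_add (q := q) hB hp hv, typeCount_add,
          typeCount_below hB (A := fun _ => True) fun _ _ => trivial, hp, hv, add_comm _ (v + p)]
      simp only [g, g₂, hiff, hN, hG, true_and, if_true, mul_one]
    · simp only [g, g₂, hiff, hN, false_and, if_false, mul_zero]
  have h4 := pi_posExcursionLaw_apply (ξ := ξ) hη p q G
  have h5 : {τ : Fin p → LTree | ∑ k, (τ k).zeros = q ∧
      F (nextProfile (p, q, v) τ) (totalSize (p, q, v) τ)} =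
      {τ | ∑ k, (τ k).zeros = q ∧ G (∑ k, (τ k).edgeCount)} := by
    ext τ
    simp only [Set.mem_ofPred_eq, G, nextProfile_eq, totalSize_eq]
  rw [h1, h2, h3]
  change _ = (Measure.pi fun _ : Fin p => posExcursionLaw ξ η) {τ : Fin p → LTree |
    ∑ k, (τ k).zeros = q ∧ F (nextProfile (p, q, v) τ) (totalSize (p, q, v) τ)} * _
  rw [h5, h4]
  have hfin : treeLaw ξ η 0 Set.univ ^ q ≠ ⊤ := ENNReal.pow_ne_top (measure_ne_top _ _)
  rw [mul_comm (treeLaw ξ η 0 Set.univ ^ q), mul_assoc, ← mul_assoc (treeLaw ξ η 0 Set.univ ^ q),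
    ENNReal.mul_inv_cancel (pow_ne_zero _ hZ) hfin, one_mul]

end

/-- The law of the excursions above a level, given the profile at this level. -/
noncomputable def excursionLaw (ξ : PMF ℕ) (η : (k : ℕ) → PMF (Fin k → ℤ)) (x : ℕ × ℕ × ℕ) :
    Measure (Fin x.1 → LTree) :=
  (Measure.pi fun _ : Fin x.1 => posExcursionLaw ξ η)[|{τ | ∑ k, (τ k).zeros = x.2.1}]

/-- The size condition in `H` is an equation in `ℤ`, so it fails when `v + p > V`, just as the total
size then cannot be `V`. -/
theorem harmonicH_eq (V : ℕ) (x : ℕ × ℕ × ℕ) :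
    harmonicH ξ η V x = excursionLaw ξ η x {τ | totalSize x τ = V} := by
  obtain ⟨p, q, v⟩ := x
  rw [harmonicH, excursionLaw]
  congr 1
  ext τ
  simp only [Set.mem_ofPred_eq, totalSize]
  omega

open Classical in
/-- The transition kernel of the profile. -/
noncomputable def profileKernel (ξ : PMF ℕ) (η : (k : ℕ) → PMF (Fin k → ℤ)) (x : ℕ × ℕ × ℕ) :
    PMF (ℕ × ℕ × ℕ) :=
  if _ : IsProbabilityMeasure ((excursionLaw ξ η x).map (nextProfile x)) then
    ((excursionLaw ξ η x).map (nextProfile x)).toPMF else PMF.pure 0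

section

variable (hη : ∀ (k : ℕ) (e : Fin k → ℤ), η k e ≠ 0 → ∀ i, e i = -1 ∨ e i = 0 ∨ e i = 1)
  (hZ : treeLaw ξ η 0 Set.univ ≠ 0) {m : ℕ} (hm : 1 ≤ m) {J : ℕ → Prop} (hJ : ∀ k, J k → k ≤ m)
  (hJm : J m) (s : ℕ → ℕ × ℕ × ℕ)

-- A trivial `F` expresses the mass of the past through the same constant, so the quotient is the
-- conditioned law of the excursions. It depends on the past only through `s m`, whatever set `J` of
-- earlier levels is observed.
include hη hZ hm hJ hJm in
theorem treeLaw_eq_mul_excursionLaw (F : ℕ × ℕ × ℕ → ℕ → Prop) :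
    treeLaw ξ η 0 {t | (∀ k, J k → t.profile k = s k) ∧ F (t.profile (m + 1)) t.size} =
      treeLaw ξ η 0 {t | ∀ k, J k → t.profile k = s k} *
        excursionLaw ξ η (s m) {τ | F (nextProfile (s m) τ) (totalSize (s m) τ)} := by
  obtain ⟨L, hL⟩ := exists_treeLaw_eq_mul hη hZ hm J hJ hJm s
  have h1 := hL fun _ _ => True
  simp only [and_true] at h1
  rw [hL F, h1, excursionLaw, cond_apply .of_discrete]
  by_cases h0 : (Measure.pi fun _ : Fin (s m).1 => posExcursionLaw ξ η)
      {τ | ∑ k, (τ k).zeros = (s m).2.1} = 0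
  · rw [h0, measure_mono_null (fun τ hτ => hτ.1) h0]
    simp
  · rw [mul_right_comm, ← mul_assoc, ENNReal.mul_inv_cancel h0 (measure_ne_top _ _), one_mul]
    rfl

include hη hZ hm hJ hJm in
theorem treeLaw_and_size_eq (V : ℕ) :
    treeLaw ξ η 0 {t | (∀ k, J k → t.profile k = s k) ∧ t.size = V} =
      treeLaw ξ η 0 {t | ∀ k, J k → t.profile k = s k} * harmonicH ξ η V (s m) := by
  rw [treeLaw_eq_mul_excursionLaw hη hZ hm hJ hJm s fun _ n => n = V, harmonicH_eq]

include hη hZ hm hJ hJm in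
theorem treeLaw_and_profile_eq (y : ℕ × ℕ × ℕ) :
    treeLaw ξ η 0 {t | (∀ k, J k → t.profile k = s k) ∧ t.profile (m + 1) = y} =
      treeLaw ξ η 0 {t | ∀ k, J k → t.profile k = s k} * profileKernel ξ η (s m) y := by
  by_cases h0 : treeLaw ξ η 0 {t | ∀ k, J k → t.profile k = s k} = 0
  · rw [h0, zero_mul]
    exact measure_mono_null (fun t ht => ht.1) h0
  rw [treeLaw_eq_mul_excursionLaw hη hZ hm hJ hJm s fun z _ => z = y]
  congr 1
  -- A past of positive mass has a non-null conditioning event, so the default value of the kernel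
  -- is not used.
  have hne : (Measure.pi fun _ : Fin (s m).1 => posExcursionLaw ξ η)
      {τ | ∑ k, (τ k).zeros = (s m).2.1} ≠ 0 := by
    intro h
    obtain ⟨L, hL⟩ := exists_treeLaw_eq_mul hη hZ hm J hJ hJm s
    have h1 := hL fun _ _ => True
    simp only [and_true] at h1
    exact h0 (by rw [h1, h, zero_mul])
  have hprob : IsProbabilityMeasure (excursionLaw ξ η (s m)) := cond_isProbabilityMeasure hne
  have hprob' : IsProbabilityMeasure ((excursionLaw ξ η (s m)).map (nextProfile (s m))) :=
    Measure.isProbabilityMeasure_map Measurable.of_discrete.aemeasurable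
  rw [profileKernel, dif_pos hprob', Measure.toPMF_apply,
    Measure.map_apply .of_discrete .of_discrete]
  rfl

end

end LTree

/-! ### Markov property, harmonicity and the `h`-transform -/

theorem proposition4p5
    (ξ : PMF ℕ) (hξ : ∑' k : ℕ, ξ k * (k : ℝ≥0∞) ≤ 1)
    (η : (k : ℕ) → PMF (Fin k → ℤ))
    (hη : ∀ (k : ℕ) (e : Fin k → ℤ), η k e ≠ 0 → ∀ i, e i = -1 ∨ e i = 0 ∨ e i = 1)
    (V : ℕ) (hV : 1 ≤ V) (hZ : 0 < treeLaw ξ η 0 {t | t.size = V}) :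
    ∃ P : ℕ × ℕ × ℕ → PMF (ℕ × ℕ × ℕ),
      -- `P` is the transition kernel of the process under the unconditioned law
      IsMarkovChainWith (treeLaw ξ η 0) LTree.profile (fun x y => P x y) ∧
      -- `H` is the conditional probability of having `V` edges, and is harmonic for `P`
      (∀ m : ℕ, 1 ≤ m → ∀ x, treeLaw ξ η 0 {t | t.profile m = x} ≠ 0 →
        harmonicH ξ η V x = (treeLaw ξ η 0)[|{t | t.profile m = x}] {t | t.size = V} ∧
        ∑' y, P x y * harmonicH ξ η V y = harmonicH ξ η V x) ∧
      -- `H` does not vanish on the states visited under the conditioned law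
      (∀ m : ℕ, 1 ≤ m → ∀ x, sizedLaw ξ η V {t | t.profile m = x} ≠ 0 →
        harmonicH ξ η V x ≠ 0) ∧
      -- under the conditioned law the process is a Markov chain, with the `h`-transformed kernel
      IsMarkovChainWith (sizedLaw ξ η V) LTree.profile
        (fun x y => harmonicH ξ η V y / harmonicH ξ η V x * P x y) := by
  have hZ' : treeLaw ξ η 0 Set.univ ≠ 0 := (hZ.trans_le (measure_mono (Set.subset_univ _))).ne'
  have hsize : ∀ m, 1 ≤ m → ∀ x, treeLaw ξ η 0 {t | t.profile m = x ∧ t.size = V} =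
      treeLaw ξ η 0 {t | t.profile m = x} * harmonicH ξ η V x := by
    intro m hm x
    have := LTree.treeLaw_and_size_eq hη hZ' hm (J := fun k => k = m) (fun k hk => hk.le) rfl
      (fun _ => x) V
    simpa using this
  have hnext : ∀ m, 1 ≤ m → ∀ x y, treeLaw ξ η 0 {t | t.profile m = x ∧ t.profile (m + 1) = y} =
      treeLaw ξ η 0 {t | t.profile m = x} * LTree.profileKernel ξ η x y := by
    intro m hm x y
    have := LTree.treeLaw_and_profile_eq hη hZ' hm (J := fun k => k = m) (fun k hk => hk.le) rfl
      (fun _ => x) y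
    simpa using this
  have hnext_size : ∀ m, 1 ≤ m → ∀ x y,
      treeLaw ξ η 0 {t | (t.profile m = x ∧ t.profile (m + 1) = y) ∧ t.size = V} =
      treeLaw ξ η 0 {t | t.profile m = x ∧ t.profile (m + 1) = y} * harmonicH ξ η V y := by
    intro m hm x y
    -- Observing the two levels `m` and `m + 1` shows that the size depends on the pair only through
    -- the later state `y`.
    have := LTree.treeLaw_and_size_eq hη hZ' (m := m + 1) (by omega) (J := fun k => k = m ∨ k = m + 1)
      (fun k hk => by omega) (Or.inr rfl) (fun k => if k = m then x else y) V
    simpa [or_imp, forall_and] using this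
  refine ⟨LTree.profileKernel ξ η, ?_, ?_, ?_, ?_⟩
  · intro m hm s hs y
    have := LTree.treeLaw_and_profile_eq hη hZ' hm (J := fun k => 1 ≤ k ∧ k ≤ m) (fun k hk => hk.2)
      ⟨hm, le_rfl⟩ s y
    simp only [and_imp] at this
    rw [cond_apply .of_discrete]
    change _ * treeLaw ξ η 0 {t | (∀ k, 1 ≤ k → k ≤ m → t.profile k = s k) ∧
      t.profile (m + 1) = y} = _
    rw [this, ← mul_assoc, ENNReal.inv_mul_cancel hs (measure_ne_top _ _), one_mul]
  · intro m hm x hx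
    refine ⟨?_, ?_⟩
    · rw [cond_apply .of_discrete]
      change _ = _ * treeLaw ξ η 0 {t | t.profile m = x ∧ t.size = V}
      rw [hsize m hm x, ← mul_assoc, ENNReal.inv_mul_cancel hx (measure_ne_top _ _), one_mul]
    -- Multiplied by the mass of `{t | t.profile m = x}`, harmonicity is the decomposition of the
    -- event `profile m = x`, `size = V` according to the next profile.
    · refine (ENNReal.mul_right_inj hx (measure_ne_top _ _)).1 ?_
      rw [← ENNReal.tsum_mul_left, ← hsize m hm x]
      have : ∀ y, treeLaw ξ η 0 {t | t.profile m = x} *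
          (LTree.profileKernel ξ η x y * harmonicH ξ η V y) =
          treeLaw ξ η 0 {t | (t.profile m = x ∧ t.profile (m + 1) = y) ∧ t.size = V} := by
        intro y
        rw [← mul_assoc, ← hnext m hm x y, hnext_size m hm x y]
      simp only [this]
      rw [← measure_iUnion _ fun _ => .of_discrete]
      · congr 1
        ext t
        simp
      · intro y y' hy
        refine Set.disjoint_left.2 fun t ht ht' => hy ?_
        rw [← ht.1.2, ht'.1.2]
  · intro m hm x hx h0
    apply hx
    rw [sizedLaw, cond_apply .of_discrete, Set.inter_comm]
    change _ * treeLaw ξ η 0 {t | t.profile m = x ∧ t.size = V} = 0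
    rw [hsize m hm x, h0, mul_zero, mul_zero]
  · intro m hm s hs y
    have h1 := LTree.treeLaw_and_size_eq hη hZ' hm (J := fun k => 1 ≤ k ∧ k ≤ m) (fun k hk => hk.2)
      ⟨hm, le_rfl⟩ s V
    have h2 := LTree.treeLaw_and_profile_eq hη hZ' hm (J := fun k => 1 ≤ k ∧ k ≤ m) (fun k hk => hk.2)
      ⟨hm, le_rfl⟩ s y
    have h3 := LTree.treeLaw_and_size_eq hη hZ' (m := m + 1) (by omega)
      (J := fun k => 1 ≤ k ∧ k ≤ m + 1) (fun k hk => hk.2) ⟨by omega, le_rfl⟩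
      (fun k => if k ≤ m then s k else y) V
    have h4 : {t : LTree | ∀ k, 1 ≤ k ∧ k ≤ m + 1 → t.profile k = if k ≤ m then s k else y} =
        {t | (∀ k, 1 ≤ k ∧ k ≤ m → t.profile k = s k) ∧ t.profile (m + 1) = y} := by
      ext t
      refine ⟨fun h => ⟨fun k hk => ?_, ?_⟩, fun h k hk => ?_⟩
      · simpa [hk.2] using h k ⟨hk.1, by omega⟩
      · simpa using h (m + 1) ⟨by omega, le_rfl⟩
      · by_cases hkm : k ≤ m
        · rw [if_pos hkm]
          exact h.1 k ⟨hk.1, hkm⟩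
        · rw [if_neg hkm, show k = m + 1 by omega]
          exact h.2
    set A : Set LTree := {t | ∀ k, 1 ≤ k ∧ k ≤ m → t.profile k = s k} with hA
    have hA' : {t : LTree | ∀ k, 1 ≤ k → k ≤ m → t.profile k = s k} = A := by
      simp only [hA, and_imp]
    rw [hA'] at hs ⊢
    have e1 : treeLaw ξ η 0 ({t | t.size = V} ∩ A) =
        treeLaw ξ η 0 A * harmonicH ξ η V (s m) := by
      rw [Set.inter_comm]
      exact h1
    have e2 : treeLaw ξ η 0 ({t | t.size = V} ∩ A ∩ {t | t.profile (m + 1) = y}) =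
        treeLaw ξ η 0 A * LTree.profileKernel ξ η (s m) y * harmonicH ξ η V y := by
      rw [h4, h2, if_neg (by omega)] at h3
      rw [← h3]
      congr 1
      ext t
      have := Set.ext_iff.1 h4 t
      simp only [Set.mem_ofPred_eq] at this
      simp only [Set.mem_inter_iff, Set.mem_ofPred_eq, this, hA]
      tauto
    -- A past of positive conditioned mass makes both factors nonzero; the mass of `A` can then be
    -- cancelled in the quotient of `e2` by `e1`, which leaves the `h`-transform.
    have hne : treeLaw ξ η 0 A * harmonicH ξ η V (s m) ≠ 0 := by
      intro h
      apply hs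
      rw [sizedLaw, cond_apply .of_discrete, e1, h, mul_zero]
    have ha := left_ne_zero_of_mul hne
    have ha' : treeLaw ξ η 0 A ≠ ⊤ := measure_ne_top _ _
    rw [sizedLaw, cond_cond_eq_cond_inter .of_discrete .of_discrete, cond_apply .of_discrete, e1, e2,
      ENNReal.mul_inv (Or.inl ha) (Or.inl ha'), mul_assoc (treeLaw ξ η 0 A), mul_comm _⁻¹ _⁻¹,
      mul_assoc, ← mul_assoc _ (treeLaw ξ η 0 A), ENNReal.inv_mul_cancel ha ha', one_mul]
    simp only [div_eq_mul_inv]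
    ring
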